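/- \textbf{Setting.} Let $Y=f+\varepsilon$ where $f\in\mathbb{R}^n$ and $\varepsilon_1,\dots,\varepsilon_n$ are independent centered Gaussian variables with common variance $\sigma^2$. Let $\Lambda$ be a finite set and, for $\lambda\in\Lambda$, let $A_\lambda$ be an arbitrary deterministic real $n\times n$ matrix and $\widehat f_\lambda=A_\lambda Y$. Denote by $\Pi_S$ the orthogonal projection of $\mathbb{R}^n$ onto a linear subspace $S$, by $\|\cdot\|$ the Euclidean norm, by $A^*$ the transpose of $A$ and by $\mathrm{rg}$ the range. For a real $n\times n$ matrix $A$ let $A^+:\mathrm{rg}(A)\to\mathrm{rg}(A^*)$ be the inverse of the bijection $\mathrm{rg}(A^*)\to\mathrm{rg}(A)$ induced by $A$, let $\overline\Pi:\mathrm{rg}(A)\to\mathrm{rg}(A^*)$ be the restriction to $\mathrm{rg}(A)$ of the orthogonal projection onto $\mathrm{rg}(A^*)$, and let $S_A\subset\mathrm{rg}(A)$ be the linear span of the right-singular vectors of $A^+-\overline\Pi$ associated with singular values smaller than $1$ ($S_A=\{0\}$ if there are none). Put $S_\lambda=S_{A_\lambda}$. For each $\lambda$ let $\mathbb{S}_\lambda$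 be a (deterministic) set of linear subspaces of $\mathbb{R}^n$ with $S_\lambda\in\mathbb{S}_\lambda$, and let $\mathbb{S}=\bigcup_{\lambda}\mathbb{S}_\lambda$. Let $a\ge 1$ and $\Delta(S)=a(1\vee\dim S)$ for $S\in\mathbb{S}$. For $S\in\mathbb{S}$ (with $\dim S\le n-2$), $\mathrm{pen}_\Delta(S)\ge 0$ is the solution of \[ \mathbb{E}\Big[\Big(U-\frac{\mathrm{pen}_\Delta(S)}{n-\dim S}\,V\Big)_+\Big]=e^{-\Delta(S)}, \] where $U,V$ are independent $\chi^2$ variables with $\dim S+1$ and $n-\dim S-1$ degrees of freedom. For $K>1$ and $\alpha>0$ put $\mathrm{pen}=K\,\mathrm{pen}_\Delta$, $\widehat\sigma_S^2=\|Y-\Pi_SY\|^2/(n-\dim S)$ and \[ \mathrm{crit}_\alpha(\widehat f_\lambda)=\inf_{S\in\mathbb{S}_\lambda}\Big[\|Y-\Pi_S\widehat f_\lambda\|^2+\alpha\|\widehat f_\lambda-\Pi_S\widehat f_\lambda\|^2+\mathrm{pen}(S)\,\widehat\sigma_S^2\Big], \] and let $\widehat\lambda$ be a (measurable) minimizer of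 $\lambda\mapsto\mathrm{crit}_\alpha(\widehat f_\lambda)$ over $\Lambda$. \textbf{Result.} Let $K>1$, $\kappa\in(0,1)$ and $\alpha>0$. (1) There exists a constant $C>0$ depending on $K,\alpha,\kappa$ only such that, whenever $\mathbb{S}$ is finite or countable, $\dim S\le n-2$ and $\Delta(S)\le\kappa n$ for all $S\in\mathbb{S}$, and $\sum_{S\in\mathbb{S}}e^{-\Delta(S)}\le 1$, the variable $\|f-\widehat f_{\widehat\lambda}\|^2$ is integrable and \[ C\,a^{-1}\,\mathbb{E}\big[\|f-\widehat f_{\widehat\lambda}\|^2\big]\le\inf_{\lambda\in\Lambda}\mathbb{E}\big[\|f-\widehat f_\lambda\|^2\big]+\sigma^2 . \] (2) For every $n$, every real $n\times n$ matrix $A$ and every $f\in\mathbb{R}^n$, \[ \|(I-\Pi_{S_A})Af\|\le\|f-Af\|\qquad\text{and}\qquad \dim S_A\le 4\,\mathrm{Tr}(A^*A). \] -/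

import Mathlib

open MeasureTheory ProbabilityTheory Module

noncomputable section

/-! ### The spaces attached to a linear estimator -/

/-- For a real `n × n` matrix `A`, the operator from `rg(A*)` to `rg(A)` induced by `A`. -/
def inducedMap {n : ℕ} (A : Matrix (Fin n) (Fin n) ℝ) :
    LinearMap.range (LinearMap.adjoint A.toEuclideanLin) →ₗ[ℝ]
      LinearMap.range A.toEuclideanLin :=
  A.toEuclideanLin.rangeRestrict.comp
    (LinearMap.range (LinearMap.adjoint A.toEuclideanLin)).subtype

theorem inducedMap_bijective {n : ℕ} (A : Matrix (Fin n) (Fin n) ℝ) :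
    Function.Bijective (inducedMap A) := by
  set T := A.toEuclideanLin with hT
  have hker : (LinearMap.ker T)ᗮ = LinearMap.range (LinearMap.adjoint T) := T.orthogonal_ker
  constructor
  · rw [← LinearMap.ker_eq_bot, LinearMap.ker_eq_bot']
    rintro ⟨x, hx⟩ h
    have h1 : T x = 0 := congrArg Subtype.val h
    rw [← hker, Submodule.mem_orthogonal] at hx
    have h2 := hx x (LinearMap.mem_ker.2 h1)
    exact Subtype.ext (inner_self_eq_zero.1 h2)
  · rintro ⟨_, x, rfl⟩
    refine ⟨⟨(LinearMap.ker T)ᗮ.starProjection x, ?_⟩, ?_⟩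
    · rw [← hker]
      exact Submodule.starProjection_apply_mem _ _
    · apply Subtype.ext
      have h : x - (LinearMap.ker T)ᗮ.starProjection x ∈ (LinearMap.ker T)ᗮᗮ :=
        Submodule.sub_starProjection_mem_orthogonal x
      rw [Submodule.orthogonal_orthogonal, LinearMap.mem_ker, map_sub, sub_eq_zero] at h
      exact h.symm

/-- `A⁺ : rg(A) → rg(A*)`, the inverse of the operator `rg(A*) → rg(A)` induced by `A`. -/
def pinv {n : ℕ} (A : Matrix (Fin n) (Fin n) ℝ) :
    LinearMap.range A.toEuclideanLin →ₗ[ℝ]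
      LinearMap.range (LinearMap.adjoint A.toEuclideanLin) :=
  ((LinearEquiv.ofBijective (inducedMap A) (inducedMap_bijective A)).symm : _ →ₗ[ℝ] _)

/-- `Π̄ : rg(A) → rg(A*)`, the restriction to `rg(A)` of the orthogonal projection
of `ℝⁿ` onto `rg(A*)`. -/
def projBar {n : ℕ} (A : Matrix (Fin n) (Fin n) ℝ) :
    LinearMap.range A.toEuclideanLin →ₗ[ℝ]
      LinearMap.range (LinearMap.adjoint A.toEuclideanLin) :=
  ((LinearMap.range (LinearMap.adjoint A.toEuclideanLin)).orthogonalProjectionOnto :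
      EuclideanSpace ℝ (Fin n) →ₗ[ℝ] _).comp (LinearMap.range A.toEuclideanLin).subtype

/-- `v` is a right-singular vector of `M` associated to the singular value `s`. -/
def IsRightSingularVector {E F : Type*} [NormedAddCommGroup E] [InnerProductSpace ℝ E]
    [FiniteDimensional ℝ E] [NormedAddCommGroup F] [InnerProductSpace ℝ F]
    [FiniteDimensional ℝ F] (M : E →ₗ[ℝ] F) (s : ℝ) (v : E) : Prop :=
  0 ≤ s ∧ v ≠ 0 ∧ LinearMap.adjoint M (M v) = s ^ 2 • v

/-- The subspace `S_A` of `ℝⁿ` spanned by the right-singular vectors of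
`A⁺ - Π̄ : rg(A) → rg(A*)` associated to singular values smaller than `1`. -/
def singularSpace {n : ℕ} (A : Matrix (Fin n) (Fin n) ℝ) :
    Submodule ℝ (EuclideanSpace ℝ (Fin n)) :=
  (Submodule.span ℝ
    {v | ∃ s : ℝ, s < 1 ∧ IsRightSingularVector (pinv A - projBar A) s v}).map
      (LinearMap.range A.toEuclideanLin).subtype

/-! ### The selection procedure -/

/-- The `χ²` distribution with `k` degrees of freedom. -/
def chiSqMeasure (k : ℕ) : Measure ℝ :=
  (Measure.pi fun _ : Fin k => gaussianReal 0 1).map fun x => ∑ i, x i ^ 2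

/-- The weight function `Δ(S) = a (1 ∨ dim S)`. -/
def weight {n : ℕ} (a : ℝ) (S : Submodule ℝ (EuclideanSpace ℝ (Fin n))) : ℝ :=
  a * max 1 (finrank ℝ S : ℝ)

/-- `x ≥ 0` solves `E[(U - x / (n - d) * V)₊] = e^{-δ}`, where `U`, `V` are independent `χ²`
variables with `d + 1` and `n - d - 1` degrees of freedom. -/
def IsPenValue (n d : ℕ) (δ x : ℝ) : Prop :=
  0 ≤ x ∧
    ∫ p : ℝ × ℝ, max (p.1 - x / ((n : ℝ) - d) * p.2) 0
      ∂((chiSqMeasure (d + 1)).prod (chiSqMeasure (n - d - 1))) = Real.exp (-δ)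

/-- The function `pen_Δ`: the solution `x = pen_Δ(S)` of the equation in `IsPenValue` with
`d = dim S`, `δ = Δ(S)`.  When `dim S ≤ n - 2` and `Δ(S) ≥ 0` the left-hand side is continuous
and strictly decreasing in `x ≥ 0`, from `dim S + 1` at `x = 0` to `0` at infinity, so that the set
below is a singleton. -/
def penDelta {n : ℕ} (Δ : Submodule ℝ (EuclideanSpace ℝ (Fin n)) → ℝ)
    (S : Submodule ℝ (EuclideanSpace ℝ (Fin n))) : ℝ :=
  sInf {x : ℝ | IsPenValue n (finrank ℝ S) (Δ S) x}

/-- The variance estimator `‖Y - Π_S Y‖² / (n - dim S)`. -/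
def sigmaHatSq {n : ℕ} (S : Submodule ℝ (EuclideanSpace ℝ (Fin n)))
    (Y : EuclideanSpace ℝ (Fin n)) : ℝ :=
  ‖Y - S.starProjection Y‖ ^ 2 / ((n : ℝ) - finrank ℝ S)

/-- The criterion `crit_α` of an estimator taking the value `g` at the observation `Y`:
`inf_{S ∈ 𝕊} (‖Y - Π_S g‖² + α ‖g - Π_S g‖² + pen(S) σ̂²_S)`. -/
def crit {n : ℕ} (α : ℝ) (pen : Submodule ℝ (EuclideanSpace ℝ (Fin n)) → ℝ)
    (𝕊 : Set (Submodule ℝ (EuclideanSpace ℝ (Fin n)))) (Y g : EuclideanSpace ℝ (Fin n)) : ℝ :=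
  ⨅ S : 𝕊, (‖Y - S.1.starProjection g‖ ^ 2 + α * ‖g - S.1.starProjection g‖ ^ 2 +
    pen S.1 * sigmaHatSq S.1 Y)

/-- The observation `Y = f + ε`. -/
def observation {n : ℕ} {Ω : Type*} (f : EuclideanSpace ℝ (Fin n)) (ε : Fin n → Ω → ℝ) (ω : Ω) :
    EuclideanSpace ℝ (Fin n) :=
  f + WithLp.toLp 2 fun i => ε i ω

end

/-! Part (2). For M = A⁺ - Π̄ one has M(Af) = Π_{rg(A*)}(f - Af), of norm at most ‖f - Af‖. Deleting
from Af its components along singular vectors with s < 1 leaves components that M does not shrink,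
hence the bias bound. On S_A, ‖Mv‖ ≤ ‖v‖ gives ‖A⁺v‖ ≤ 2‖v‖, so every w in A⁺S_A satisfies ‖w‖² ≤
4‖Aw‖². Summing over an orthonormal basis of A⁺S_A bounds its dimension by 4 Tr(A*A).

Part (1). For each S choose W containing S and f, with dim W = dim S + 1. As f - Π_S g lies in W,
the cross term in ‖Y - Π_S g‖² involves only Π_W ε, while the residual in σ̂²_S is at least ‖ε - Π_W
ε‖. Hence each term of the criterion dominates a multiple of the loss, plus ‖ε‖², minus K(‖Π_W ε‖² -
pen_Δ(S)/(n - dim S) ‖ε - Π_W ε‖²)₊ (`loss_le_crit_term`). By definition of pen_Δ, this positive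
part has mean σ²e^{-Δ(S)}; summing over S costs at most σ² (`exists_deviation_bound`).

Conversely, the criterion at λ is at most its term at S_λ. By part (2) and the bound of pen_Δ by a
constant, depending on κ, times Δ, the mean of that term minus ‖ε‖² is at most a constant times
a(risk + σ²) (`exists_crit_bound`). Comparing the criteria at λ̂ and λ cancels ‖ε‖². -/

theorem Submodule.norm_sub_starProjection_le {E : Type*} [NormedAddCommGroup E]
    [InnerProductSpace ℝ E] (U : Submodule ℝ E) [U.HasOrthogonalProjection] (y : E) {x : E}
    (hx : x ∈ U) : ‖y - U.starProjection y‖ ≤ ‖y - x‖ := by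
  rw [Submodule.starProjection_minimal]
  exact ciInf_le ⟨0, by rintro _ ⟨z, rfl⟩; positivity⟩ (⟨x, hx⟩ : U)

/-! ### Singular vectors with singular value below one -/

section SingularVectors

variable {E F : Type*} [NormedAddCommGroup E] [InnerProductSpace ℝ E]
  [FiniteDimensional ℝ E] [NormedAddCommGroup F] [InnerProductSpace ℝ F]
  [FiniteDimensional ℝ F]

theorem exists_singularValue_basis (M : E →ₗ[ℝ] F) :
    ∃ (b : OrthonormalBasis (Fin (finrank ℝ E)) ℝ E) (μ : Fin (finrank ℝ E) → ℝ),
      (∀ i, LinearMap.adjoint M (M (b i)) = μ i • b i) ∧ (∀ i, 0 ≤ μ i) ∧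
      ∀ v, ‖M v‖ ^ 2 = ∑ i, μ i * inner ℝ (b i) v ^ 2 := by
  have hT : (LinearMap.adjoint M ∘ₗ M).IsSymmetric := fun x y => by
    rw [LinearMap.comp_apply, LinearMap.comp_apply, LinearMap.adjoint_inner_left,
      LinearMap.adjoint_inner_right]
  refine ⟨hT.eigenvectorBasis rfl, hT.eigenvalues rfl, ?_, ?_, ?_⟩
  · intro i
    exact hT.apply_eigenvectorBasis rfl i
  · intro i
    have h := hT.apply_eigenvectorBasis rfl i
    have h1 : ‖M (hT.eigenvectorBasis rfl i)‖ ^ 2 = hT.eigenvalues rfl i := by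
      rw [← real_inner_self_eq_norm_sq, ← LinearMap.adjoint_inner_right]
      rw [LinearMap.comp_apply] at h
      rw [h, inner_smul_right]
      simp
    rw [← h1]; positivity
  · intro v
    rw [← real_inner_self_eq_norm_sq, ← LinearMap.adjoint_inner_right,
      ← (hT.eigenvectorBasis rfl).sum_inner_mul_inner]
    refine Finset.sum_congr rfl fun i _ => ?_
    have h := hT.apply_eigenvectorBasis rfl i
    rw [LinearMap.comp_apply] at h
    have h2 : inner ℝ (hT.eigenvectorBasis rfl i) (LinearMap.adjoint M (M v)) =
        inner ℝ (LinearMap.adjoint M (M (hT.eigenvectorBasis rfl i))) v :=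
      (hT (hT.eigenvectorBasis rfl i) v).symm
    rw [h2, h, inner_smul_left, real_inner_comm]
    simp
    ring

/-- Take w to be the part of v along eigenvectors of M*M with eigenvalue below 1; on the remaining
ones M does not decrease the norm. -/
theorem exists_mem_span_norm_sub_le (M : E →ₗ[ℝ] F) (v : E) :
    ∃ w ∈ Submodule.span ℝ {v | ∃ s : ℝ, s < 1 ∧ IsRightSingularVector M s v},
      ‖v - w‖ ≤ ‖M v‖ := by
  obtain ⟨b, μ, hb, hμ, hM⟩ := exists_singularValue_basis M
  refine ⟨∑ i, if μ i < 1 then inner ℝ (b i) v • b i else 0, ?_, ?_⟩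
  · refine Submodule.sum_mem _ fun i _ => ?_
    split_ifs with h
    · refine Submodule.smul_mem _ _ (Submodule.subset_span ⟨√(μ i), ?_, Real.sqrt_nonneg _,
        b.orthonormal.ne_zero i, ?_⟩)
      · rwa [Real.sqrt_lt' one_pos, one_pow]
      · rw [Real.sq_sqrt (hμ i), hb]
    · exact Submodule.zero_mem _
  · refine le_of_sq_le_sq ?_ (norm_nonneg _)
    rw [hM, ← b.sum_sq_inner_right]
    refine Finset.sum_le_sum fun i _ => ?_
    have h1 : inner ℝ (b i) (∑ j, if μ j < 1 then inner ℝ (b j) v • b j else 0) =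
        if μ i < 1 then inner ℝ (b i) v else 0 := by
      rw [inner_sum, Finset.sum_eq_single i]
      · split_ifs <;> simp [inner_smul_right]
      · intro j _ hj
        split_ifs
        · rw [inner_smul_right, b.inner_eq_zero hj.symm, mul_zero]
        · simp
      · simp
    rw [inner_sub_right, h1]
    split_ifs with h
    · simpa using mul_nonneg (hμ i) (sq_nonneg _)
    · rw [sub_zero]
      exact le_mul_of_one_le_left (sq_nonneg _) (not_lt.1 h)

theorem norm_map_le_of_mem_span (M : E →ₗ[ℝ] F) {v : E}
    (hv : v ∈ Submodule.span ℝ {v | ∃ s : ℝ, s < 1 ∧ IsRightSingularVector M s v}) :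
    ‖M v‖ ≤ ‖v‖ := by
  obtain ⟨b, μ, hb, hμ, hM⟩ := exists_singularValue_basis M
  -- The generators of the span need not belong to the basis b, but eigenvectors of M*M with
  -- distinct eigenvalues are orthogonal, and s² < 1 ≤ μ i.
  have key : ∀ i, 1 ≤ μ i → inner ℝ (b i) v = 0 := by
    intro i hi
    induction hv using Submodule.span_induction with
    | mem u hu =>
      obtain ⟨s, hs, hs0, -, hu⟩ := hu
      have h1 : inner ℝ (b i) (LinearMap.adjoint M (M u)) =
          inner ℝ (LinearMap.adjoint M (M (b i))) u := by
        rw [LinearMap.adjoint_inner_right, LinearMap.adjoint_inner_left]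
      rw [hu, hb, inner_smul_right, inner_smul_left] at h1
      have h2 : s ^ 2 < μ i := by nlinarith
      have h3 : (s ^ 2 - μ i) * inner ℝ (b i) u = 0 := by
        simp only [conj_trivial] at h1; linarith
      rcases mul_eq_zero.1 h3 with h | h
      · linarith
      · exact h
    | zero => simp
    | add x y _ _ hx hy => rw [inner_add_right, hx, hy, add_zero]
    | smul c x _ hx => rw [inner_smul_right, hx, mul_zero]
  refine le_of_sq_le_sq ?_ (norm_nonneg _)
  rw [hM, ← b.sum_sq_inner_right]
  refine Finset.sum_le_sum fun i _ => ?_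
  rcases le_or_gt 1 (μ i) with h | h
  · simp [key i h]
  · exact mul_le_of_le_one_left (sq_nonneg _) h.le

end SingularVectors

/-! ### Bias and dimension bounds for S_A -/

section LinearEstimator

variable {n : ℕ}

theorem pinv_toEuclideanLin (A : Matrix (Fin n) (Fin n) ℝ) (f : EuclideanSpace ℝ (Fin n)) :
    (pinv A ⟨A.toEuclideanLin f, LinearMap.mem_range_self _ f⟩ : EuclideanSpace ℝ (Fin n)) =
      (LinearMap.range (LinearMap.adjoint A.toEuclideanLin)).starProjection f := by
  have h : pinv A ⟨A.toEuclideanLin f, LinearMap.mem_range_self _ f⟩ =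
      ⟨(LinearMap.range (LinearMap.adjoint A.toEuclideanLin)).starProjection f,
        Submodule.starProjection_apply_mem _ _⟩ := by
    refine (LinearEquiv.symm_apply_eq _).2 (Subtype.ext ?_)
    change A.toEuclideanLin f = A.toEuclideanLin _
    have h1 := Submodule.sub_starProjection_mem_orthogonal
      (K := LinearMap.range (LinearMap.adjoint A.toEuclideanLin)) f
    have h2 : (LinearMap.range (LinearMap.adjoint A.toEuclideanLin))ᗮ =
        LinearMap.ker A.toEuclideanLin := by
      rw [← LinearMap.orthogonal_ker, Submodule.orthogonal_orthogonal]
    rw [h2, LinearMap.mem_ker, map_sub, sub_eq_zero] at h1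
    exact h1
  rw [h]

theorem toEuclideanLin_pinv (A : Matrix (Fin n) (Fin n) ℝ)
    (v : LinearMap.range A.toEuclideanLin) :
    A.toEuclideanLin (pinv A v : EuclideanSpace ℝ (Fin n)) = v :=
  congrArg Subtype.val ((LinearEquiv.ofBijective (inducedMap A)
    (inducedMap_bijective A)).apply_symm_apply v)

theorem norm_toEuclideanLin_sub_singularSpace_le (A : Matrix (Fin n) (Fin n) ℝ)
    (f : EuclideanSpace ℝ (Fin n)) :
    ‖A.toEuclideanLin f - (singularSpace A).starProjection (A.toEuclideanLin f)‖ ≤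
      ‖f - A.toEuclideanLin f‖ := by
  set v : LinearMap.range A.toEuclideanLin :=
    ⟨A.toEuclideanLin f, LinearMap.mem_range_self _ f⟩ with hv
  obtain ⟨w, hw, hvw⟩ := exists_mem_span_norm_sub_le (pinv A - projBar A) v
  have hw' : (w : EuclideanSpace ℝ (Fin n)) ∈ singularSpace A := Submodule.mem_map_of_mem hw
  refine (Submodule.norm_sub_starProjection_le _ _ hw').trans (hvw.trans ?_)
  have h : (((pinv A - projBar A) v : _) : EuclideanSpace ℝ (Fin n)) =
      (LinearMap.range (LinearMap.adjoint A.toEuclideanLin)).starProjection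
        (f - A.toEuclideanLin f) := by
    rw [LinearMap.sub_apply, Submodule.coe_sub, hv, pinv_toEuclideanLin, map_sub]
    rfl
  rw [← Submodule.norm_coe, h]
  exact Submodule.norm_starProjection_apply_le _ _

theorem trace_transpose_mul_self (A : Matrix (Fin n) (Fin n) ℝ) :
    (A.transpose * A).trace =
      ∑ i, ‖A.transpose.toEuclideanLin (EuclideanSpace.single i 1)‖ ^ 2 := by
  rw [Matrix.trace_mul_comm]
  refine Finset.sum_congr rfl fun i _ => ?_
  rw [EuclideanSpace.real_norm_sq_eq]
  simp [Matrix.mul_apply, sq]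

theorem toEuclideanLin_apply_eq_inner (A : Matrix (Fin n) (Fin n) ℝ)
    (w : EuclideanSpace ℝ (Fin n)) (i : Fin n) :
    A.toEuclideanLin w i =
      inner ℝ (A.transpose.toEuclideanLin (EuclideanSpace.single i 1)) w := by
  simp [Matrix.toLpLin_apply, Matrix.mulVec, dotProduct, PiLp.inner_apply, mul_comm]

/-- Expand ‖A w_j‖² over the rows of A and apply Bessel's inequality to each row. -/
theorem sum_norm_toEuclideanLin_sq_le {ι : Type*} [Fintype ι] (A : Matrix (Fin n) (Fin n) ℝ)
    {w : ι → EuclideanSpace ℝ (Fin n)} (hw : Orthonormal ℝ w) :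
    ∑ j, ‖A.toEuclideanLin (w j)‖ ^ 2 ≤ (A.transpose * A).trace := by
  rw [trace_transpose_mul_self]
  simp_rw [EuclideanSpace.real_norm_sq_eq (A.toEuclideanLin _), toEuclideanLin_apply_eq_inner]
  rw [Finset.sum_comm]
  refine Finset.sum_le_sum fun i _ => ?_
  simpa [real_inner_comm] using hw.sum_inner_products_le
    (A.transpose.toEuclideanLin (EuclideanSpace.single i 1)) (s := Finset.univ)

theorem finrank_singularSpace_le (A : Matrix (Fin n) (Fin n) ℝ) :
    (finrank ℝ (singularSpace A) : ℝ) ≤ 4 * (A.transpose * A).trace := by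
  set S := Submodule.span ℝ
    {v | ∃ s : ℝ, s < 1 ∧ IsRightSingularVector (pinv A - projBar A) s v} with hS
  have hinj : Function.Injective (pinv A) := 
    (LinearEquiv.ofBijective (inducedMap A) (inducedMap_bijective A)).symm.injective
  -- V = A⁺S_A has the dimension of S_A because A⁺ is injective, and on it A shrinks norms by at
  -- most a factor 2.
  set V := (S.map (pinv A)).map (LinearMap.range (LinearMap.adjoint A.toEuclideanLin)).subtype
    with hV
  have h1 : finrank ℝ (singularSpace A) = finrank ℝ S :=
    (Submodule.equivMapOfInjective _ (Submodule.subtype_injective _) S).finrank_eq.symm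
  have h2 : finrank ℝ V = finrank ℝ S := by
    rw [hV, ← Submodule.map_comp]
    exact (Submodule.equivMapOfInjective _
      (Subtype.val_injective.comp hinj) S).finrank_eq.symm
  have hle : ∀ w ∈ V, ‖w‖ ^ 2 ≤ 4 * ‖A.toEuclideanLin w‖ ^ 2 := by
    rintro _ ⟨_, ⟨v, hv, rfl⟩, rfl⟩
    rw [Submodule.subtype_apply, toEuclideanLin_pinv]
    have h3 : ‖(pinv A - projBar A) v‖ ≤ ‖v‖ := norm_map_le_of_mem_span _ hv
    have h4 : ‖projBar A v‖ ≤ ‖v‖ :=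
      Submodule.norm_orthogonalProjectionOnto_apply_le _ (v : EuclideanSpace ℝ (Fin n))
    have h5 : ‖pinv A v‖ ≤ 2 * ‖v‖ := by
      calc ‖pinv A v‖ = ‖(pinv A - projBar A) v + projBar A v‖ := by simp
        _ ≤ _ := norm_add_le _ _
        _ ≤ _ := by linarith
    change ‖pinv A v‖ ^ 2 ≤ 4 * ‖v‖ ^ 2
    nlinarith [norm_nonneg (pinv A v), norm_nonneg v]
  have h6 := sum_norm_toEuclideanLin_sq_le A
    ((stdOrthonormalBasis ℝ V).orthonormal.comp_linearIsometry V.subtypeₗᵢ)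
  have h7 : (finrank ℝ V : ℝ) = ∑ i : Fin (finrank ℝ V),
      ‖((stdOrthonormalBasis ℝ V i : V) : EuclideanSpace ℝ (Fin n))‖ ^ 2 := by
    have h8 : ∀ i, ‖((stdOrthonormalBasis ℝ V i : V) : EuclideanSpace ℝ (Fin n))‖ = 1 :=
      (stdOrthonormalBasis ℝ V).orthonormal.1
    simp only [h8, one_pow, Finset.sum_const, Finset.card_univ, Fintype.card_fin, nsmul_eq_mul,
      mul_one]
  rw [h1, ← h2, h7]
  refine (Finset.sum_le_sum fun i _ => hle _ (Subtype.coe_prop _)).trans ?_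
  rw [← Finset.mul_sum]
  exact mul_le_mul_of_nonneg_left h6 (by norm_num)

end LinearEstimator

/-! ### Moments and Laplace transforms of χ² variables -/

section ChiSquare

theorem integral_exp_mul_sq_gaussianReal {s : ℝ} (hs : s < 1 / 2) :
    ∫ x, Real.exp (s * x ^ 2) ∂gaussianReal 0 1 = (√(1 - 2 * s))⁻¹ := by
  rw [integral_gaussianReal_eq_integral_smul one_ne_zero]
  have h1 : ∀ x : ℝ, gaussianPDFReal 0 1 x • Real.exp (s * x ^ 2) =
      (√(2 * Real.pi))⁻¹ * Real.exp (-(1 / 2 - s) * x ^ 2) := by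
    intro x
    rw [gaussianPDFReal, smul_eq_mul, mul_assoc, ← Real.exp_add]
    simp only [NNReal.coe_one, mul_one, sub_zero]
    congr 2
    ring
  simp_rw [h1]
  rw [integral_const_mul, integral_gaussian, ← Real.sqrt_inv, ← Real.sqrt_inv,
    ← Real.sqrt_mul (by positivity)]
  congr 1
  have : 1 - 2 * s ≠ 0 := by linarith
  have : 1 / 2 - s ≠ 0 := by linarith
  field_simp

theorem integrable_sq_gaussianReal (v : NNReal) :
    Integrable (fun x => x ^ 2) (gaussianReal 0 v) :=
  (memLp_id_gaussianReal' 2 (by simp)).integrable_sq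

theorem integral_sq_gaussianReal (v : NNReal) : ∫ x, x ^ 2 ∂gaussianReal 0 v = v := by
  have h := variance_id_gaussianReal (μ := 0) (v := v)
  rw [variance_eq_integral aemeasurable_id] at h
  simpa using h

theorem measurable_sum_sq (k : ℕ) : Measurable fun x : Fin k → ℝ => ∑ i, x i ^ 2 := by
  fun_prop

instance isProbabilityMeasure_chiSqMeasure (k : ℕ) : IsProbabilityMeasure (chiSqMeasure k) :=
  Measure.isProbabilityMeasure_map (measurable_sum_sq k).aemeasurable

theorem ae_nonneg_chiSqMeasure (k : ℕ) : ∀ᵐ u ∂chiSqMeasure k, 0 ≤ u := by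
  rw [chiSqMeasure, ae_map_iff (measurable_sum_sq k).aemeasurable measurableSet_Ici]
  exact ae_of_all _ fun x => by positivity

theorem integrable_eval_sq (k : ℕ) (i : Fin k) : Integrable (fun x : Fin k → ℝ => x i ^ 2)
    (Measure.pi fun _ => gaussianReal 0 1) :=
  integrable_comp_eval (μ := fun _ : Fin k => gaussianReal 0 1) (f := fun x => x ^ 2)
    (integrable_sq_gaussianReal 1)

theorem integrable_id_chiSqMeasure (k : ℕ) : Integrable (fun u => u) (chiSqMeasure k) := by
  rw [chiSqMeasure, integrable_map_measure (by fun_prop) (measurable_sum_sq k).aemeasurable]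
  exact integrable_finsetSum _ fun i _ => integrable_eval_sq k i

theorem integral_id_chiSqMeasure (k : ℕ) : ∫ u, u ∂chiSqMeasure k = k := by
  rw [chiSqMeasure, integral_map (measurable_sum_sq k).aemeasurable (by fun_prop),
    integral_finsetSum _ fun i _ => integrable_eval_sq k i]
  have h : ∀ i : Fin k, ∫ x : Fin k → ℝ, x i ^ 2 ∂Measure.pi (fun _ => gaussianReal 0 1) = 1 :=
    fun i => (integral_comp_eval (μ := fun _ => gaussianReal 0 1) (f := fun x => x ^ 2)
      (by fun_prop)).trans (by simp [integral_sq_gaussianReal])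
  simp [h]

theorem integral_exp_mul_chiSqMeasure (k : ℕ) {s : ℝ} (hs : s < 1 / 2) :
    ∫ u, Real.exp (s * u) ∂chiSqMeasure k = (√(1 - 2 * s))⁻¹ ^ k := by
  rw [chiSqMeasure, integral_map (measurable_sum_sq k).aemeasurable (by fun_prop)]
  simp_rw [Finset.mul_sum, Real.exp_sum]
  rw [integral_fintype_prod_eq_pow (fun x : ℝ => Real.exp (s * x ^ 2)),
    integral_exp_mul_sq_gaussianReal hs, Fintype.card_fin]

theorem integrable_exp_mul_chiSqMeasure (k : ℕ) {s : ℝ} (hs : s < 1 / 2) :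
    Integrable (fun u => Real.exp (s * u)) (chiSqMeasure k) := by
  -- The integral of a non-integrable function is 0 by convention, so the nonzero value just
  -- computed forces integrability.
  refine Integrable.of_integral_ne_zero ?_
  rw [integral_exp_mul_chiSqMeasure k hs]
  have : 0 < √(1 - 2 * s) := Real.sqrt_pos.2 (by linarith)
  positivity

theorem integrable_posPart_chiSqMeasure (k l : ℕ) (c : ℝ) :
    Integrable (fun p : ℝ × ℝ => max (p.1 - c * p.2) 0)
      ((chiSqMeasure k).prod (chiSqMeasure l)) :=
  (((integrable_id_chiSqMeasure k).comp_fst _).sub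
    (((integrable_id_chiSqMeasure l).comp_snd _).const_mul c)).pos_part

theorem ae_nonneg_prod_chiSqMeasure (k l : ℕ) :
    ∀ᵐ p ∂(chiSqMeasure k).prod (chiSqMeasure l), 0 ≤ p.1 ∧ 0 ≤ p.2 :=
  (Measure.quasiMeasurePreserving_fst.ae (ae_nonneg_chiSqMeasure k)).and
    (Measure.quasiMeasurePreserving_snd.ae (ae_nonneg_chiSqMeasure l))

theorem continuousOn_integral_posPart_chiSqMeasure (k l : ℕ) :
    ContinuousOn (fun c : ℝ => ∫ p : ℝ × ℝ, max (p.1 - c * p.2) 0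
      ∂(chiSqMeasure k).prod (chiSqMeasure l)) (Set.Ici 0) := by
  refine continuousOn_of_dominated (bound := fun p => p.1)
    (fun c _ => (integrable_posPart_chiSqMeasure k l c).aestronglyMeasurable) ?_
    ((integrable_id_chiSqMeasure k).comp_fst _) (ae_of_all _ fun p => by fun_prop)
  intro c hc
  filter_upwards [ae_nonneg_prod_chiSqMeasure k l] with p hp
  rw [Real.norm_of_nonneg (le_max_right _ _)]
  exact max_le (by nlinarith [mul_nonneg (Set.mem_Ici.1 hc) hp.2]) hp.1

theorem integral_posPart_chiSqMeasure_zero (k l : ℕ) :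
    ∫ p : ℝ × ℝ, max (p.1 - 0 * p.2) 0 ∂(chiSqMeasure k).prod (chiSqMeasure l) = k := by
  have h : (fun p : ℝ × ℝ => max (p.1 - 0 * p.2) 0) =ᵐ[(chiSqMeasure k).prod (chiSqMeasure l)]
      fun p => p.1 := by
    filter_upwards [ae_nonneg_prod_chiSqMeasure k l] with p hp
    rw [zero_mul, sub_zero, max_eq_left hp.1]
  rw [integral_congr_ae h]
  have := integral_prod_mul (μ := chiSqMeasure k) (ν := chiSqMeasure l) (fun u => u) fun _ => 1
  simpa [integral_id_chiSqMeasure] using this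

/-- From x₊ ≤ 4e^{x/4}, independence splits the bound into Laplace transforms at 1/4 and -c/4. -/
theorem integral_posPart_chiSqMeasure_le (k l : ℕ) {c : ℝ} (hc : 0 ≤ c) :
    ∫ p : ℝ × ℝ, max (p.1 - c * p.2) 0 ∂(chiSqMeasure k).prod (chiSqMeasure l) ≤
      4 * (√2 ^ k * (√(1 + c / 2))⁻¹ ^ l) := by
  have h1 : ∀ x : ℝ, max x 0 ≤ 4 * Real.exp (1 / 4 * x) := fun x =>
    max_le (by linarith [Real.add_one_le_exp (1 / 4 * x)]) (by positivity)
  have h2 := integral_exp_mul_chiSqMeasure k (s := 1 / 4) (by norm_num)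
  have h3 := integral_exp_mul_chiSqMeasure l (s := -(c / 4)) (by linarith)
  have h4 := integrable_exp_mul_chiSqMeasure k (s := 1 / 4) (by norm_num)
  have h5 := integrable_exp_mul_chiSqMeasure l (s := -(c / 4)) (by linarith)
  have h6 := integral_prod_mul (μ := chiSqMeasure k) (ν := chiSqMeasure l)
    (fun u => Real.exp (1 / 4 * u)) fun u => Real.exp (-(c / 4) * u)
  calc _ ≤ ∫ p : ℝ × ℝ, 4 * (Real.exp (1 / 4 * p.1) * Real.exp (-(c / 4) * p.2))
        ∂(chiSqMeasure k).prod (chiSqMeasure l) := by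
        refine integral_mono (integrable_posPart_chiSqMeasure k l c)
          ((h4.mul_prod h5).const_mul 4) fun p => (h1 _).trans_eq ?_
        rw [← Real.exp_add]
        congr 2
        ring
    _ = _ := by
        rw [integral_const_mul, h6, h2, h3, ← Real.sqrt_inv]
        congr 5
        · norm_num
        · ring

end ChiSquare

/-! ### Existence and size of the penalty -/

section Penalty

variable {n d : ℕ} {δ : ℝ}

/-- Closedness makes the infimum defining `penDelta` an actual solution, without proving uniqueness.
-/
theorem isClosed_setOf_isPenValue (hd : d + 2 ≤ n) : IsClosed {x | IsPenValue n d δ x} := by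
  have hN : (0 : ℝ) < (n : ℝ) - d := by
    have : ((d + 2 : ℕ) : ℝ) ≤ n := by exact_mod_cast hd
    push_cast at this; linarith
  have h : ContinuousOn (fun x : ℝ => ∫ p : ℝ × ℝ, max (p.1 - x / ((n : ℝ) - d) * p.2) 0
      ∂((chiSqMeasure (d + 1)).prod (chiSqMeasure (n - d - 1)))) (Set.Ici 0) :=
    (continuousOn_integral_posPart_chiSqMeasure _ _).comp (f := fun x => x / ((n : ℝ) - d))
      (by fun_prop) fun x hx => div_nonneg hx hN.le
  exact h.preimage_isClosed_of_isClosed isClosed_Ici isClosed_singleton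

/-- Intermediate value theorem: at x = 0 the expectation is d + 1 ≥ 1 ≥ e^{-δ}. -/
theorem exists_isPenValue_le (hd : d + 2 ≤ n) (hδ : 0 ≤ δ) {x₀ : ℝ} (hx₀ : 0 ≤ x₀)
    (h : ∫ p : ℝ × ℝ, max (p.1 - x₀ / ((n : ℝ) - d) * p.2) 0
      ∂((chiSqMeasure (d + 1)).prod (chiSqMeasure (n - d - 1))) ≤ Real.exp (-δ)) :
    ∃ x ≤ x₀, IsPenValue n d δ x := by
  have hN : (0 : ℝ) < (n : ℝ) - d := by
    have : ((d + 2 : ℕ) : ℝ) ≤ n := by exact_mod_cast hd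
    push_cast at this; linarith
  have hc : ContinuousOn (fun x : ℝ => ∫ p : ℝ × ℝ, max (p.1 - x / ((n : ℝ) - d) * p.2) 0
      ∂((chiSqMeasure (d + 1)).prod (chiSqMeasure (n - d - 1)))) (Set.Icc 0 x₀) :=
    (continuousOn_integral_posPart_chiSqMeasure _ _).comp (f := fun x => x / ((n : ℝ) - d))
      (by fun_prop) fun x hx => div_nonneg hx.1 hN.le
  obtain ⟨x, hx, hxe⟩ := (intermediate_value_Icc' hx₀ hc :) (show Real.exp (-δ) ∈ _ from ⟨h, by
    simp only [zero_div, integral_posPart_chiSqMeasure_zero]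
    push_cast
    linarith [Real.exp_le_one_iff.2 (neg_nonpos.2 hδ), (Nat.cast_nonneg d : (0 : ℝ) ≤ d)]⟩)
  exact ⟨x, hx.2, hx.1, hxe⟩

theorem exists_isPenValue_le_mul {κ : ℝ} (hκ0 : 0 < κ) (hκ1 : κ < 1) (hd : d + 2 ≤ n)
    (hδ1 : 1 ≤ δ) (hδd : (d : ℝ) ≤ δ) (hδ : δ ≤ κ * n) :
    ∃ x ≤ (40 * Real.exp (20 * (κ / (1 - κ)))) * δ, IsPenValue n d δ x := by
  have hd' : (d : ℝ) + 2 ≤ n := by exact_mod_cast hd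
  set N : ℝ := (n : ℝ) - d with hN
  have hN2 : 2 ≤ N := by linarith
  have hκN : (1 - κ) * δ ≤ κ * N := by
    nlinarith
  -- Since N ≥ 2, (N - 1)z/2 ≥ Nz/4 = 5δ, which beats the exponent 3 + d ≤ 4δ coming from 4·√2^(d+1)
  -- and leaves -δ. The bound δ ≤ κn keeps z bounded, so that e^z - 1 ≤ ze^z is linear in z and x₀ =
  -- cN is linear in δ.
  set z : ℝ := 20 * (δ / N) with hz
  have hz0 : 0 ≤ z := by positivity
  have hzM : z ≤ 20 * (κ / (1 - κ)) := by
    refine mul_le_mul_of_nonneg_left ?_ (by norm_num)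
    rw [div_le_div_iff₀ (by linarith) (by linarith)]
    linarith
  set c : ℝ := 2 * (z * Real.exp (20 * (κ / (1 - κ)))) with hc
  have hc0 : 0 ≤ c := by positivity
  have hxc : 40 * Real.exp (20 * (κ / (1 - κ))) * δ = c * N := by
    rw [hc, hz]; field_simp; ring
  have hexp : Real.exp z ≤ 1 + c / 2 := by
    have h1 : 1 - z ≤ Real.exp (-z) := by linarith [Real.add_one_le_exp (-z)]
    have h2 : Real.exp z - 1 ≤ z * Real.exp z := by
      have := mul_le_mul_of_nonneg_right h1 (Real.exp_pos z).le
      rw [← Real.exp_add, neg_add_cancel, Real.exp_zero] at this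
      linarith
    have h3 := mul_le_mul_of_nonneg_left (Real.exp_le_exp.2 hzM) hz0
    rw [hc]; linarith
  refine exists_isPenValue_le hd (by linarith) (by positivity) ?_
  rw [hxc, mul_div_assoc, div_self (by linarith), mul_one]
  refine (integral_posPart_chiSqMeasure_le _ _ hc0).trans ?_
  have hs2 : √2 ≤ Real.exp 1 := by
    rw [Real.sqrt_le_left (Real.exp_pos _).le]
    nlinarith [Real.add_one_le_exp (1 : ℝ)]
  have hs4 : (4 : ℝ) ≤ Real.exp 2 := by
    have := Real.add_one_le_exp (1 : ℝ)
    rw [show (2 : ℝ) = 1 + 1 by norm_num, Real.exp_add]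
    nlinarith
  have hs3 : (√(1 + c / 2))⁻¹ ≤ Real.exp (-(z / 2)) := by
    rw [Real.exp_neg]
    refine inv_anti₀ (Real.exp_pos _) (Real.le_sqrt_of_sq_le ?_)
    rw [← Real.exp_nat_mul]
    convert hexp using 2
    push_cast; ring
  calc 4 * (√2 ^ (d + 1) * (√(1 + c / 2))⁻¹ ^ (n - d - 1))
      ≤ Real.exp 2 * (Real.exp 1 ^ (d + 1) * Real.exp (-(z / 2)) ^ (n - d - 1)) := by
        gcongr
    _ = Real.exp (2 + ((d + 1 : ℕ) * 1 + (n - d - 1 : ℕ) * (-(z / 2)))) := by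
        rw [← Real.exp_nat_mul, ← Real.exp_nat_mul, ← Real.exp_add, ← Real.exp_add]
    _ ≤ Real.exp (-δ) := by
        refine Real.exp_le_exp.2 ?_
        have h1 : ((n - d - 1 : ℕ) : ℝ) = N - 1 := by
          rw [Nat.cast_sub (by omega), Nat.cast_sub (by omega)]; simp [hN]
        rw [h1]
        push_cast
        have h2 : N * z = 20 * δ := by rw [hz]; field_simp
        nlinarith

variable {Δ : Submodule ℝ (EuclideanSpace ℝ (Fin n)) → ℝ}
  {S : Submodule ℝ (EuclideanSpace ℝ (Fin n))}

theorem isPenValue_penDelta_and_le {κ : ℝ} (hκ0 : 0 < κ) (hκ1 : κ < 1)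
    (hd : finrank ℝ S + 2 ≤ n) (hΔ1 : 1 ≤ Δ S) (hΔd : (finrank ℝ S : ℝ) ≤ Δ S)
    (hΔ : Δ S ≤ κ * n) :
    IsPenValue n (finrank ℝ S) (Δ S) (penDelta Δ S) ∧
      penDelta Δ S ≤ (40 * Real.exp (20 * (κ / (1 - κ)))) * Δ S := by
  obtain ⟨x, hx, hxp⟩ := exists_isPenValue_le_mul hκ0 hκ1 hd hΔ1 hΔd hΔ
  have hb : BddBelow {x : ℝ | IsPenValue n (finrank ℝ S) (Δ S) x} := ⟨0, fun y hy => hy.1⟩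
  exact ⟨(isClosed_setOf_isPenValue hd).csInf_mem ⟨x, hxp⟩ hb, (csInf_le hb hxp).trans hx⟩

end Penalty

/-! ### Projections of a standard Gaussian vector -/

section GaussianProjection

variable {E : Type*} [NormedAddCommGroup E] [InnerProductSpace ℝ E] [FiniteDimensional ℝ E]

theorem Submodule.exists_orthonormalBasis_adapted (W : Submodule ℝ E) {k l : ℕ}
    (hk : finrank ℝ W = k) (hl : finrank ℝ Wᗮ = l) :
    ∃ b : OrthonormalBasis (Fin k ⊕ Fin l) ℝ E,
      (∀ x, ‖W.starProjection x‖ ^ 2 = ∑ i, inner ℝ (b (Sum.inl i)) x ^ 2) ∧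
      ∀ x, ‖x - W.starProjection x‖ ^ 2 = ∑ i, inner ℝ (b (Sum.inr i)) x ^ 2 := by
  subst hk hl
  set v := stdOrthonormalBasis ℝ W
  set w := stdOrthonormalBasis ℝ Wᗮ
  have hv : ∀ i, (v.prod w).map W.orthogonalDecomposition.symm (Sum.inl i) = (v i : E) := by
    intro i
    rw [OrthonormalBasis.map_apply, LinearIsometryEquiv.symm_apply_eq]
    simp [eq_comm (a := (0 : Wᗮ)), Submodule.orthogonalProjectionOnto_eq_zero_iff]
  have hw : ∀ i, (v.prod w).map W.orthogonalDecomposition.symm (Sum.inr i) = (w i : E) := by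
    intro i
    rw [OrthonormalBasis.map_apply, LinearIsometryEquiv.symm_apply_eq]
    simp [eq_comm (a := (0 : W)), Submodule.orthogonalProjectionOnto_eq_zero_iff]
  refine ⟨(v.prod w).map W.orthogonalDecomposition.symm, fun x => ?_, fun x => ?_⟩
  · rw [Submodule.starProjection_apply, Submodule.norm_coe, ← v.sum_sq_inner_right]
    simp_rw [hv, Submodule.inner_orthogonalProjectionOnto_eq_of_mem_left]
  · rw [← Submodule.starProjection_orthogonal_val, Submodule.starProjection_apply,
      Submodule.norm_coe, ← w.sum_sq_inner_right]
    simp_rw [hw, Submodule.inner_orthogonalProjectionOnto_eq_of_mem_left]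

variable [MeasurableSpace E] [BorelSpace E]

/-- In an orthonormal basis adapted to W ⊕ Wᗮ the coordinates are independent standard Gaussians,
and the two squared norms use disjoint blocks. -/
theorem stdGaussian_map_norm_starProjection_sq (W : Submodule ℝ E) {k l : ℕ}
    (hk : finrank ℝ W = k) (hl : finrank ℝ Wᗮ = l) :
    (stdGaussian E).map
        (fun x => (‖W.starProjection x‖ ^ 2, ‖x - W.starProjection x‖ ^ 2)) =
      (chiSqMeasure k).prod (chiSqMeasure l) := by
  obtain ⟨b, hb1, hb2⟩ := W.exists_orthonormalBasis_adapted hk hl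
  have h := measurePreserving_sumPiEquivProdPi (X := fun _ : Fin k ⊕ Fin l => ℝ)
    fun _ => gaussianReal 0 1
  rw [chiSqMeasure, chiSqMeasure, Measure.map_prod_map _ _ (measurable_sum_sq k)
    (measurable_sum_sq l), ← h.map_eq, Measure.map_map (by fun_prop) h.measurable,
    stdGaussian_eq_map_pi_orthonormalBasis b, Measure.map_map (by fun_prop) (by fun_prop)]
  congr 1
  funext y
  simp only [Function.comp_apply, hb1, hb2, b.orthonormal.inner_right_fintype]
  rfl

theorem integrable_norm_starProjection_sq_stdGaussian (W : Submodule ℝ E) {k l : ℕ}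
    (hk : finrank ℝ W = k) (hl : finrank ℝ Wᗮ = l) (c : ℝ) :
    Integrable (fun x => max (‖W.starProjection x‖ ^ 2 - c * ‖x - W.starProjection x‖ ^ 2) 0)
      (stdGaussian E) := by
  have h := integrable_posPart_chiSqMeasure k l c
  rw [← stdGaussian_map_norm_starProjection_sq W hk hl] at h
  exact (integrable_map_measure (by fun_prop) (by fun_prop)).1 h

theorem integral_norm_starProjection_sq_stdGaussian (W : Submodule ℝ E) {k l : ℕ}
    (hk : finrank ℝ W = k) (hl : finrank ℝ Wᗮ = l) (c : ℝ) :
    ∫ x, max (‖W.starProjection x‖ ^ 2 - c * ‖x - W.starProjection x‖ ^ 2) 0 ∂stdGaussian E =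
      ∫ p : ℝ × ℝ, max (p.1 - c * p.2) 0 ∂(chiSqMeasure k).prod (chiSqMeasure l) := by
  rw [← stdGaussian_map_norm_starProjection_sq W hk hl, integral_map (by fun_prop) (by fun_prop)]

theorem memLp_inner_stdGaussian (w : E) :
    MemLp (fun x => inner ℝ w x) 2 (stdGaussian E) :=
  IsGaussian.memLp_dual (stdGaussian E) (innerSL ℝ w) 2 (by norm_num)

theorem integral_inner_stdGaussian (w : E) : ∫ x, inner ℝ w x ∂stdGaussian E = 0 :=
  integral_strongDual_stdGaussian (innerSL ℝ w)

theorem integral_inner_sq_stdGaussian (w : E) :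
    ∫ x, inner ℝ w x ^ 2 ∂stdGaussian E = ‖w‖ ^ 2 := by
  have h := variance_dual_stdGaussian (innerSL ℝ w)
  rw [variance_eq_integral (by fun_prop), integral_strongDual_stdGaussian,
    innerSL_apply_norm] at h
  simpa using h

theorem integrable_add_inner_sq_stdGaussian (c s : ℝ) (w : E) :
    Integrable (fun x => (c + s * inner ℝ w x) ^ 2) (stdGaussian E) :=
  ((memLp_const c).add ((memLp_inner_stdGaussian w).const_mul s)).integrable_sq

theorem integral_add_inner_sq_stdGaussian (c s : ℝ) (w : E) :
    ∫ x, (c + s * inner ℝ w x) ^ 2 ∂stdGaussian E = c ^ 2 + s ^ 2 * ‖w‖ ^ 2 := by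
  have h1 : ∀ x, (c + s * inner ℝ w x) ^ 2 =
      c ^ 2 + 2 * c * s * inner ℝ w x + s ^ 2 * inner ℝ w x ^ 2 := fun x => by ring
  have h2 := (memLp_inner_stdGaussian w).integrable (by norm_num)
  have h3 := (memLp_inner_stdGaussian w).integrable_sq
  simp_rw [h1]
  have h4 : Integrable (fun x => c ^ 2 + 2 * c * s * inner ℝ w x) (stdGaussian E) :=
    (integrable_const _).add (h2.const_mul _)
  rw [integral_add h4 (h3.const_mul _),
    integral_add (integrable_const _) (h2.const_mul _), integral_const_mul, integral_const_mul,
    integral_inner_stdGaussian, integral_inner_sq_stdGaussian]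
  simp

end GaussianProjection

/-! ### Transfer to noise of variance σ² -/

section Noise

variable {n : ℕ}

theorem norm_add_toEuclideanLin_smul_sq (A : Matrix (Fin n) (Fin n) ℝ) (s : ℝ)
    (c x : EuclideanSpace ℝ (Fin n)) :
    ‖c + A.toEuclideanLin (s • x)‖ ^ 2 = ∑ i, (c i + s *
      inner ℝ (A.transpose.toEuclideanLin (EuclideanSpace.single i 1)) x) ^ 2 := by
  rw [EuclideanSpace.real_norm_sq_eq]
  refine Finset.sum_congr rfl fun i _ => ?_
  rw [PiLp.add_apply, toEuclideanLin_apply_eq_inner, inner_smul_right]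

/-- Writing the noise as σ times a standard Gaussian also covers σ = 0. -/
theorem map_toLp_pi_gaussianReal (σ : NNReal) :
    (Measure.pi fun _ : Fin n => gaussianReal 0 (σ ^ 2)).map (WithLp.toLp 2) =
      (stdGaussian (EuclideanSpace ℝ (Fin n))).map fun x => (σ : ℝ) • x := by
  have h : gaussianReal 0 (σ ^ 2) = (gaussianReal 0 1).map ((σ : ℝ) * ·) := by
    rw [gaussianReal_map_const_mul]
    congr 1
    · simp
    · ext; simp
  rw [← map_pi_eq_stdGaussian, h, ← Measure.pi_map_pi fun _ => by fun_prop,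
    Measure.map_map (by fun_prop) (by fun_prop), Measure.map_map (by fun_prop) (by fun_prop)]
  rfl

variable {Ω : Type*} [MeasurableSpace Ω] {P : Measure Ω} {σ : NNReal}
  {e : Ω → EuclideanSpace ℝ (Fin n)}

theorem hasLaw_toLp_gaussian [IsProbabilityMeasure P] {ε : Fin n → Ω → ℝ} (hε : iIndepFun ε P)
    (hlaw : ∀ i, HasLaw (ε i) (gaussianReal 0 (σ ^ 2)) P) :
    HasLaw (fun ω => WithLp.toLp 2 fun i => ε i ω)
      ((stdGaussian (EuclideanSpace ℝ (Fin n))).map fun x => (σ : ℝ) • x) P := by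
  have hm : AEMeasurable (fun ω i => ε i ω) P := aemeasurable_pi_lambda _ fun i =>
    (hlaw i).aemeasurable
  have hm2 : Measurable (WithLp.toLp 2 : (Fin n → ℝ) → EuclideanSpace ℝ (Fin n)) := by fun_prop
  refine ⟨hm2.comp_aemeasurable hm, ?_⟩
  rw [← map_toLp_pi_gaussianReal]
  have h := hε.map_fun_eq_pi_map fun i => (hlaw i).aemeasurable
  simp_rw [fun i => (hlaw i).map_eq] at h
  rw [← h, AEMeasurable.map_map_of_aemeasurable hm2.aemeasurable hm]
  rfl

variable (he : HasLaw e ((stdGaussian (EuclideanSpace ℝ (Fin n))).map fun x => (σ : ℝ) • x) P)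
include he

theorem integrable_comp_noise {g : EuclideanSpace ℝ (Fin n) → ℝ} (hg : Continuous g)
    (h : Integrable (fun x => g ((σ : ℝ) • x)) (stdGaussian (EuclideanSpace ℝ (Fin n)))) :
    Integrable (fun ω => g (e ω)) P := by
  have h1 : Integrable g (P.map e) := by
    rw [he.map_eq]
    exact (integrable_map_measure hg.aestronglyMeasurable (by fun_prop)).2 h
  exact (integrable_map_measure hg.aestronglyMeasurable he.aemeasurable).1 h1

theorem integral_comp_noise {g : EuclideanSpace ℝ (Fin n) → ℝ} (hg : Continuous g) :
    ∫ ω, g (e ω) ∂P =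
      ∫ x, g ((σ : ℝ) • x) ∂stdGaussian (EuclideanSpace ℝ (Fin n)) := by
  rw [← integral_map (φ := e) he.aemeasurable hg.aestronglyMeasurable, he.map_eq,
    integral_map (by fun_prop) hg.aestronglyMeasurable]

theorem integrable_norm_add_noise_sq (A : Matrix (Fin n) (Fin n) ℝ)
    (c : EuclideanSpace ℝ (Fin n)) :
    Integrable (fun ω => ‖c + A.toEuclideanLin (e ω)‖ ^ 2) P := by
  have hA := A.toEuclideanLin.continuous_of_finiteDimensional
  refine integrable_comp_noise he (g := fun x => ‖c + A.toEuclideanLin x‖ ^ 2) (by fun_prop) ?_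
  simp_rw [norm_add_toEuclideanLin_smul_sq]
  exact integrable_finsetSum _ fun i _ => integrable_add_inner_sq_stdGaussian _ _ _

theorem integral_norm_add_noise_sq (A : Matrix (Fin n) (Fin n) ℝ)
    (c : EuclideanSpace ℝ (Fin n)) :
    ∫ ω, ‖c + A.toEuclideanLin (e ω)‖ ^ 2 ∂P =
      ‖c‖ ^ 2 + (σ : ℝ) ^ 2 * (A.transpose * A).trace := by
  have hA := A.toEuclideanLin.continuous_of_finiteDimensional
  rw [integral_comp_noise he (g := fun x => ‖c + A.toEuclideanLin x‖ ^ 2) (by fun_prop)]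
  simp_rw [norm_add_toEuclideanLin_smul_sq]
  rw [integral_finsetSum _ fun i _ => integrable_add_inner_sq_stdGaussian _ _ _]
  simp_rw [integral_add_inner_sq_stdGaussian]
  rw [Finset.sum_add_distrib, ← Finset.mul_sum, trace_transpose_mul_self,
    EuclideanSpace.real_norm_sq_eq]

theorem integrable_noise_sq : Integrable (fun ω => ‖e ω‖ ^ 2) P := by
  simpa using integrable_norm_add_noise_sq he 1 0

theorem integral_noise_sq : ∫ ω, ‖e ω‖ ^ 2 ∂P = (σ : ℝ) ^ 2 * n := by
  simpa using integral_norm_add_noise_sq he 1 0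

theorem integrable_posPart_noise (W : Submodule ℝ (EuclideanSpace ℝ (Fin n))) (c : ℝ) :
    Integrable (fun ω => max (‖W.starProjection (e ω)‖ ^ 2 -
      c * ‖e ω - W.starProjection (e ω)‖ ^ 2) 0) P := by
  refine integrable_comp_noise he (g := fun x => max (‖W.starProjection x‖ ^ 2 -
    c * ‖x - W.starProjection x‖ ^ 2) 0) (by fun_prop) ?_
  refine ((integrable_norm_starProjection_sq_stdGaussian W rfl rfl c).const_mul
    ((σ : ℝ) ^ 2)).congr (ae_of_all _ fun x => ?_)
  simp only [map_smul, ← smul_sub, norm_smul, mul_pow, Real.norm_eq_abs, sq_abs]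
  rw [mul_max_of_nonneg _ _ (sq_nonneg _), mul_zero]
  congr 1
  ring

theorem integral_posPart_noise (W : Submodule ℝ (EuclideanSpace ℝ (Fin n))) {k l : ℕ}
    (hk : finrank ℝ W = k) (hl : finrank ℝ Wᗮ = l) (c : ℝ) :
    ∫ ω, max (‖W.starProjection (e ω)‖ ^ 2 - c * ‖e ω - W.starProjection (e ω)‖ ^ 2) 0 ∂P =
      (σ : ℝ) ^ 2 *
        ∫ p : ℝ × ℝ, max (p.1 - c * p.2) 0 ∂(chiSqMeasure k).prod (chiSqMeasure l) := by
  rw [integral_comp_noise he (g := fun x => max (‖W.starProjection x‖ ^ 2 -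
    c * ‖x - W.starProjection x‖ ^ 2) 0) (by fun_prop),
    ← integral_norm_starProjection_sq_stdGaussian W hk hl, ← integral_const_mul]
  congr 1
  funext x
  simp only [map_smul, ← smul_sub, norm_smul, mul_pow, Real.norm_eq_abs, sq_abs]
  rw [mul_max_of_nonneg _ _ (sq_nonneg _), mul_zero]
  congr 1
  ring

theorem integral_norm_starProjection_noise_sq (W : Submodule ℝ (EuclideanSpace ℝ (Fin n))) :
    ∫ ω, ‖W.starProjection (e ω)‖ ^ 2 ∂P = (σ : ℝ) ^ 2 * finrank ℝ W := by
  -- At c = 0 the positive part is the squared norm itself.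
  have h := integral_posPart_noise he W rfl rfl 0
  rw [integral_posPart_chiSqMeasure_zero] at h
  rw [← h]
  refine integral_congr_ae (ae_of_all _ fun ω => ?_)
  simp

theorem integrable_norm_starProjection_noise_sq (W : Submodule ℝ (EuclideanSpace ℝ (Fin n))) :
    Integrable (fun ω => ‖W.starProjection (e ω)‖ ^ 2) P := by
  refine (integrable_posPart_noise he W 0).congr (ae_of_all _ fun ω => ?_)
  simp

end Noise

/-- The envelope is the sum of the X i, formed in [0, ∞] and finite almost everywhere. It dominates
every S at once, so no measurability of the criterion is needed. -/
theorem MeasureTheory.exists_integrable_forall_le {ι Ω : Type*} [Countable ι] [MeasurableSpace Ω]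
    {P : Measure Ω} {X : ι → Ω → ℝ} (hX : ∀ i, Integrable (X i) P) (hX0 : ∀ i ω, 0 ≤ X i ω)
    (hs : Summable fun i => ∫ ω, X i ω ∂P) :
    ∃ Z : Ω → ℝ, Integrable Z P ∧ (∀ᵐ ω ∂P, ∀ i, X i ω ≤ Z ω) ∧
      ∫ ω, Z ω ∂P = ∑' i, ∫ ω, X i ω ∂P := by
  have hm : ∀ i, AEMeasurable (fun ω => ENNReal.ofReal (X i ω)) P := fun i =>
    (hX i).aemeasurable.ennreal_ofReal
  have hmt : AEMeasurable (fun ω => ∑' i, ENNReal.ofReal (X i ω)) P :=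
    AEMeasurable.tsum hm
  have h0 : ∀ i, 0 ≤ ∫ ω, X i ω ∂P := fun i => integral_nonneg (hX0 i)
  have hl : ∫⁻ ω, ∑' i, ENNReal.ofReal (X i ω) ∂P = ENNReal.ofReal (∑' i, ∫ ω, X i ω ∂P) := by
    rw [lintegral_tsum hm, ENNReal.ofReal_tsum_of_nonneg h0 hs]
    exact tsum_congr fun i =>
      (ofReal_integral_eq_lintegral_ofReal (hX i) (ae_of_all _ (hX0 i))).symm
  have hlt : ∫⁻ ω, ∑' i, ENNReal.ofReal (X i ω) ∂P ≠ ⊤ := hl ▸ ENNReal.ofReal_ne_top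
  refine ⟨fun ω => (∑' i, ENNReal.ofReal (X i ω)).toReal,
    integrable_toReal_of_lintegral_ne_top hmt hlt, ?_, ?_⟩
  · filter_upwards [ae_lt_top' hmt hlt] with ω hω i
    rw [← ENNReal.ofReal_le_iff_le_toReal hω.ne]
    exact ENNReal.le_tsum i
  · rw [integral_toReal hmt (ae_lt_top' hmt hlt), hl,
      ENNReal.toReal_ofReal (tsum_nonneg h0)]

/-! ### Pathwise bounds on the criterion -/

section Deterministic

variable {n : ℕ}

theorem Submodule.exists_le_mem_finrank_eq_succ {E : Type*} [AddCommGroup E] [Module ℝ E]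
    [FiniteDimensional ℝ E] (S : Submodule ℝ E) (hS : finrank ℝ S < finrank ℝ E) (f : E) :
    ∃ W : Submodule ℝ E, S ≤ W ∧ f ∈ W ∧ finrank ℝ W = finrank ℝ S + 1 := by
  by_cases hf : f ∈ S
  · obtain ⟨g, hg⟩ : ∃ g, g ∉ S := by
      by_contra! h
      rw [(Submodule.eq_top_iff'.2 h : S = ⊤), finrank_top] at hS
      exact lt_irrefl _ hS
    -- When f already lies in S an arbitrary direction is added, so that dim W matches the dim S + 1
    -- degrees of freedom of U exactly.
    exact ⟨S ⊔ Submodule.span ℝ {g}, le_sup_left, le_sup_left (a := S) hf,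
      finrank_sup_span_singleton hg⟩
  · exact ⟨S ⊔ Submodule.span ℝ {f}, le_sup_left,
      le_sup_right (a := S) (Submodule.mem_span_singleton_self f), finrank_sup_span_singleton hf⟩

section InnerProduct

variable {E : Type*} [NormedAddCommGroup E] [InnerProductSpace ℝ E] {W : Submodule ℝ E}
  [W.HasOrthogonalProjection] {f g : E}

theorem abs_inner_sub_le_norm_starProjection (hf : f ∈ W) (hg : g ∈ W) (e : E) :
    |inner ℝ (f - g) e| ≤ ‖f - g‖ * ‖W.starProjection e‖ := by
  have h : inner ℝ (f - g) e = inner ℝ (f - g) (W.starProjection e) := by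
    have := Submodule.inner_right_of_mem_orthogonal (W.sub_mem hf hg)
      (W.sub_starProjection_mem_orthogonal e)
    rwa [inner_sub_right, sub_eq_zero] at this
  rw [h]
  exact abs_real_inner_le_norm _ _

theorem norm_add_sub_sq_eq (f e g : E) :
    ‖f + e - g‖ ^ 2 = ‖f - g‖ ^ 2 + 2 * inner ℝ (f - g) e + ‖e‖ ^ 2 := by
  rw [← norm_add_sq_real]
  congr 2
  abel

/-- Only Π_W e meets f - g, and 2xy ≤ x²/K + Ky². This weight K is the factor K in the penalty. -/
theorem le_norm_add_sub_sq (hf : f ∈ W) (hg : g ∈ W) (e : E) {K : ℝ} (hK : 0 < K) :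
    (1 - K⁻¹) * ‖f - g‖ ^ 2 - K * ‖W.starProjection e‖ ^ 2 + ‖e‖ ^ 2 ≤ ‖f + e - g‖ ^ 2 := by
  have h := (abs_le.1 (abs_inner_sub_le_norm_starProjection hf hg e)).1
  have h2 : K⁻¹ * (‖f - g‖ - K * ‖W.starProjection e‖) ^ 2 =
      K⁻¹ * ‖f - g‖ ^ 2 - 2 * (‖f - g‖ * ‖W.starProjection e‖) +
        K * ‖W.starProjection e‖ ^ 2 := by
    field_simp
    ring
  have h3 : 0 ≤ K⁻¹ * (‖f - g‖ - K * ‖W.starProjection e‖) ^ 2 := by positivity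
  rw [norm_add_sub_sq_eq]
  linarith

theorem norm_add_sub_sq_le (hf : f ∈ W) (hg : g ∈ W) (e : E) :
    ‖f + e - g‖ ^ 2 ≤ 2 * ‖f - g‖ ^ 2 + ‖W.starProjection e‖ ^ 2 + ‖e‖ ^ 2 := by
  have h := (abs_le.1 (abs_inner_sub_le_norm_starProjection hf hg e)).2
  rw [norm_add_sub_sq_eq]
  nlinarith [sq_nonneg (‖f - g‖ - ‖W.starProjection e‖)]

/-- Enlarging S to W shrinks the residual, and f ∈ W removes the signal from it. -/
theorem norm_sub_starProjection_le_of_le {S : Submodule ℝ E} [S.HasOrthogonalProjection]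
    (hSW : S ≤ W) (hf : f ∈ W) (e : E) :
    ‖e - W.starProjection e‖ ≤ ‖f + e - S.starProjection (f + e)‖ := by
  have h := W.norm_sub_starProjection_le (f + e)
    (hSW (Submodule.starProjection_apply_mem S (f + e)))
  rwa [map_add, Submodule.starProjection_eq_self_iff.2 hf, add_sub_add_left_eq_sub] at h

end InnerProduct

variable {S W : Submodule ℝ (EuclideanSpace ℝ (Fin n))} {f : EuclideanSpace ℝ (Fin n)}

theorem loss_le_crit_term (hSW : S ≤ W) (hf : f ∈ W) (hS : finrank ℝ S < n) {p K α : ℝ}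
    (hp : 0 ≤ p) (hK : 1 < K) (hα : 0 < α) (e g : EuclideanSpace ℝ (Fin n)) :
    min (1 - K⁻¹) α / 2 * ‖f - g‖ ^ 2 + ‖e‖ ^ 2 - K * max (‖W.starProjection e‖ ^ 2 -
        p / ((n : ℝ) - finrank ℝ S) * ‖e - W.starProjection e‖ ^ 2) 0 ≤
      ‖f + e - S.starProjection g‖ ^ 2 + α * ‖g - S.starProjection g‖ ^ 2 +
        K * p * sigmaHatSq S (f + e) := by
  have hN : (0 : ℝ) < (n : ℝ) - finrank ℝ S := sub_pos.2 (by exact_mod_cast hS)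
  have hK0 : 0 < K := by linarith
  have hK1 : 0 < 1 - K⁻¹ := sub_pos.2 (inv_lt_one_of_one_lt₀ hK)
  have h1 := le_norm_add_sub_sq hf (hSW (Submodule.starProjection_apply_mem S g)) e hK0
  have h2 : K * (p / ((n : ℝ) - finrank ℝ S) * ‖e - W.starProjection e‖ ^ 2) ≤
      K * p * sigmaHatSq S (f + e) := by
    rw [sigmaHatSq, mul_assoc, div_mul_eq_mul_div, mul_div_assoc]
    gcongr
    exact norm_sub_starProjection_le_of_le hSW hf e
  have h3 := mul_le_mul_of_nonneg_left (le_max_left (‖W.starProjection e‖ ^ 2 -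
    p / ((n : ℝ) - finrank ℝ S) * ‖e - W.starProjection e‖ ^ 2) 0) hK0.le
  -- The α term pays for replacing Π_S g by g; the factor 2 is the 1/2 in the final constant.
  have h4 : ‖f - g‖ ^ 2 ≤ 2 * (‖f - S.starProjection g‖ ^ 2 + ‖g - S.starProjection g‖ ^ 2) := by
    have h5 : ‖f - g‖ ≤ ‖f - S.starProjection g‖ + ‖g - S.starProjection g‖ := by
      rw [norm_sub_rev g]
      exact norm_sub_le_norm_sub_add_norm_sub _ _ _
    nlinarith [sq_nonneg (‖f - S.starProjection g‖ - ‖g - S.starProjection g‖),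
      norm_nonneg (f - g)]
  have hm0 : 0 < min (1 - K⁻¹) α := lt_min hK1 hα
  have h6 := mul_le_mul_of_nonneg_left h4 (half_pos hm0).le
  have h7 := mul_le_mul_of_nonneg_right (min_le_left (1 - K⁻¹) α)
    (sq_nonneg ‖f - S.starProjection g‖)
  have h8 := mul_le_mul_of_nonneg_right (min_le_right (1 - K⁻¹) α)
    (sq_nonneg ‖g - S.starProjection g‖)
  linarith

theorem sigmaHatSq_nonneg (hS : finrank ℝ S ≤ n) (Y : EuclideanSpace ℝ (Fin n)) :
    0 ≤ sigmaHatSq S Y :=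
  div_nonneg (sq_nonneg _) (sub_nonneg.2 (by exact_mod_cast hS))

theorem crit_le_of_mem {𝕊 : Set (Submodule ℝ (EuclideanSpace ℝ (Fin n)))} {α : ℝ}
    {pen : Submodule ℝ (EuclideanSpace ℝ (Fin n)) → ℝ} (hα : 0 ≤ α)
    (hpen : ∀ S ∈ 𝕊, 0 ≤ pen S) (hd : ∀ S ∈ 𝕊, finrank ℝ S ≤ n) (hS : S ∈ 𝕊)
    (Y g : EuclideanSpace ℝ (Fin n)) :
    crit α pen 𝕊 Y g ≤ ‖Y - S.starProjection g‖ ^ 2 + α * ‖g - S.starProjection g‖ ^ 2 +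
      pen S * sigmaHatSq S Y := by
  refine ciInf_le (f := fun S : 𝕊 => ‖Y - S.1.starProjection g‖ ^ 2 +
    α * ‖g - S.1.starProjection g‖ ^ 2 + pen S.1 * sigmaHatSq S.1 Y) ⟨0, ?_⟩ ⟨S, hS⟩
  rintro _ ⟨T, rfl⟩
  have := mul_nonneg (hpen T T.2) (sigmaHatSq_nonneg (hd T T.2) Y)
  positivity

/-- Passing from Π_S g to g = A(f + e) costs ‖g - Π_S g‖, controlled by the bias bound for Af and by
contraction for Ae. The same bias bound gives ‖f - Π_S f‖ ≤ 2‖f - Af‖ in the variance estimator. -/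
theorem crit_term_singularSpace_le (A : Matrix (Fin n) (Fin n) ℝ) (hSW : singularSpace A ≤ W)
    (hf : f ∈ W) (hS : finrank ℝ (singularSpace A) < n) {q α : ℝ} (hq : 0 ≤ q) (hα : 0 < α)
    (e : EuclideanSpace ℝ (Fin n)) :
    ‖f + e - (singularSpace A).starProjection (A.toEuclideanLin (f + e))‖ ^ 2 +
        α * ‖A.toEuclideanLin (f + e) -
          (singularSpace A).starProjection (A.toEuclideanLin (f + e))‖ ^ 2 +
        q * sigmaHatSq (singularSpace A) (f + e) - ‖e‖ ^ 2 ≤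
      4 * ‖f - A.toEuclideanLin (f + e)‖ ^ 2 + (8 + 2 * α) * ‖f - A.toEuclideanLin f‖ ^ 2 +
        (8 + 2 * α) * ‖A.toEuclideanLin e‖ ^ 2 + ‖W.starProjection e‖ ^ 2 +
        q / ((n : ℝ) - finrank ℝ (singularSpace A)) *
          (8 * ‖f - A.toEuclideanLin f‖ ^ 2 + 2 * ‖e‖ ^ 2) := by
  set S := singularSpace A with hSdef
  set T := A.toEuclideanLin
  have hN : (0 : ℝ) < (n : ℝ) - finrank ℝ S := sub_pos.2 (by exact_mod_cast hS)
  have hS0 : ‖T f - S.starProjection (T f)‖ ≤ ‖f - T f‖ :=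
    norm_toEuclideanLin_sub_singularSpace_le A f
  have hcontr : ∀ x, ‖x - S.starProjection x‖ ≤ ‖x‖ := fun x => by
    simpa using S.norm_sub_starProjection_le x S.zero_mem
  have h1 := norm_add_sub_sq_le hf
    (hSW (Submodule.starProjection_apply_mem S (T (f + e)))) e
  have h2 : ‖T (f + e) - S.starProjection (T (f + e))‖ ≤ ‖f - T f‖ + ‖T e‖ := by
    have h : T (f + e) - S.starProjection (T (f + e)) =
        (T f - S.starProjection (T f)) + (T e - S.starProjection (T e)) := by
      rw [map_add, map_add]; abel
    rw [h]
    exact (norm_add_le _ _).trans (add_le_add hS0 (hcontr _))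
  have h3 : ‖T (f + e) - S.starProjection (T (f + e))‖ ^ 2 ≤
      2 * ‖f - T f‖ ^ 2 + 2 * ‖T e‖ ^ 2 := by
    nlinarith [sq_nonneg (‖f - T f‖ - ‖T e‖),
      norm_nonneg (T (f + e) - S.starProjection (T (f + e)))]
  have h4 : ‖f - S.starProjection (T (f + e))‖ ^ 2 ≤ 2 * ‖f - T (f + e)‖ ^ 2 +
      2 * ‖T (f + e) - S.starProjection (T (f + e))‖ ^ 2 := by
    have := norm_sub_le_norm_sub_add_norm_sub f (T (f + e)) (S.starProjection (T (f + e)))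
    nlinarith [sq_nonneg (‖f - T (f + e)‖ - ‖T (f + e) - S.starProjection (T (f + e))‖),
      norm_nonneg (f - S.starProjection (T (f + e)))]
  have h5 : ‖f - S.starProjection f‖ ≤ 2 * ‖f - T f‖ := by
    have ha := S.norm_sub_starProjection_le f (Submodule.starProjection_apply_mem S (T f))
    have hb := norm_sub_le_norm_sub_add_norm_sub f (T f) (S.starProjection (T f))
    linarith
  have h6 : ‖f + e - S.starProjection (f + e)‖ ^ 2 ≤ 8 * ‖f - T f‖ ^ 2 + 2 * ‖e‖ ^ 2 := by
    have h : f + e - S.starProjection (f + e) =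
        (f - S.starProjection f) + (e - S.starProjection e) := by
      rw [map_add]; abel
    have h7 : ‖f + e - S.starProjection (f + e)‖ ≤ 2 * ‖f - T f‖ + ‖e‖ := by
      rw [h]
      exact (norm_add_le _ _).trans (add_le_add h5 (hcontr _))
    nlinarith [sq_nonneg (2 * ‖f - T f‖ - ‖e‖), norm_nonneg (f + e - S.starProjection (f + e))]
  have h8 : q * sigmaHatSq S (f + e) ≤ q / ((n : ℝ) - finrank ℝ S) *
      (8 * ‖f - T f‖ ^ 2 + 2 * ‖e‖ ^ 2) := by
    rw [sigmaHatSq, mul_div_assoc', div_mul_eq_mul_div]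
    gcongr
  have h9 := mul_le_mul_of_nonneg_left h3 hα.le
  linarith

end Deterministic

/-! ### The penalty relative to the weight Δ -/

section Weight

variable {n : ℕ} {a κ : ℝ} {S : Submodule ℝ (EuclideanSpace ℝ (Fin n))}

theorem one_le_weight (ha : 1 ≤ a) : 1 ≤ weight a S :=
  one_le_mul_of_one_le_of_one_le ha (le_max_left _ _)

theorem finrank_le_weight (ha : 1 ≤ a) : (finrank ℝ S : ℝ) ≤ weight a S :=
  (le_max_right _ _).trans (le_mul_of_one_le_left (by positivity) ha)

theorem weight_le (ha : 1 ≤ a) : weight a S ≤ a * (1 + finrank ℝ S) :=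
  mul_le_mul_of_nonneg_left (max_le (by simp) (by simp)) (by linarith)

/-- The constant bounding `pen_Δ / Δ` when `Δ ≤ κ n`. -/
noncomputable def penConst (κ : ℝ) : ℝ := 40 * Real.exp (20 * (κ / (1 - κ)))

theorem penConst_pos (κ : ℝ) : 0 < penConst κ := by
  unfold penConst; positivity

theorem isPenValue_penDelta_weight (hκ0 : 0 < κ) (hκ1 : κ < 1) (ha : 1 ≤ a)
    (hd : finrank ℝ S + 2 ≤ n) (hw : weight a S ≤ κ * n) :
    IsPenValue n (finrank ℝ S) (weight a S) (penDelta (weight a) S) :=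
  (isPenValue_penDelta_and_le hκ0 hκ1 hd (one_le_weight ha) (finrank_le_weight ha) hw).1

theorem penDelta_weight_le (hκ0 : 0 < κ) (hκ1 : κ < 1) (ha : 1 ≤ a)
    (hd : finrank ℝ S + 2 ≤ n) (hw : weight a S ≤ κ * n) :
    penDelta (weight a) S ≤ penConst κ * weight a S :=
  (isPenValue_penDelta_and_le hκ0 hκ1 hd (one_le_weight ha) (finrank_le_weight ha) hw).2

/-- As dim S ≤ Δ(S) ≤ κn, n - dim S ≥ (1 - κ)n. The factor n is that of E‖ε‖² = nσ². -/
theorem penDelta_weight_mul_div_le (hκ0 : 0 < κ) (hκ1 : κ < 1) (ha : 1 ≤ a)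
    (hd : finrank ℝ S + 2 ≤ n) (hw : weight a S ≤ κ * n) :
    penDelta (weight a) S / ((n : ℝ) - finrank ℝ S) * n ≤
      penConst κ / (1 - κ) * weight a S := by
  have hd' : (finrank ℝ S : ℝ) + 2 ≤ n := by exact_mod_cast hd
  have hκ : 0 < 1 - κ := by linarith
  have hN : (1 - κ) * n ≤ (n : ℝ) - finrank ℝ S := by
    linarith [finrank_le_weight (S := S) ha]
  have hp := (isPenValue_penDelta_weight hκ0 hκ1 ha hd hw).1
  have h1 := penDelta_weight_le hκ0 hκ1 ha hd hw
  rw [div_mul_eq_mul_div, div_mul_eq_mul_div, div_le_div_iff₀ (by linarith) hκ]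
  calc penDelta (weight a) S * n * (1 - κ)
      = penDelta (weight a) S * ((1 - κ) * n) := by ring
    _ ≤ penConst κ * weight a S * ((n : ℝ) - finrank ℝ S) :=
      mul_le_mul h1 hN (by positivity) (hp.trans h1)

theorem penDelta_weight_div_le (hκ0 : 0 < κ) (hκ1 : κ < 1) (ha : 1 ≤ a)
    (hd : finrank ℝ S + 2 ≤ n) (hw : weight a S ≤ κ * n) :
    penDelta (weight a) S / ((n : ℝ) - finrank ℝ S) ≤ penConst κ / (1 - κ) := by
  have hn : (0 : ℝ) < n := by
    have : (finrank ℝ S : ℝ) + 2 ≤ n := by exact_mod_cast hd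
    linarith [(Nat.cast_nonneg _ : (0 : ℝ) ≤ finrank ℝ S)]
  have h := penDelta_weight_mul_div_le hκ0 hκ1 ha hd hw
  have h0 : 0 < penConst κ / (1 - κ) := div_pos (penConst_pos κ) (by linarith)
  refine le_of_mul_le_mul_right (h.trans ?_) hn
  refine mul_le_mul_of_nonneg_left (hw.trans ?_) h0.le
  exact mul_le_of_le_one_left hn.le hκ1.le

end Weight

/-! ### Expected bounds and the oracle inequality -/

section Risk

variable {n : ℕ} {Ω : Type*} [MeasurableSpace Ω] {P : Measure Ω} {σ : NNReal}
  {e : Ω → EuclideanSpace ℝ (Fin n)} {a κ : ℝ}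

theorem integrable_loss [IsFiniteMeasure P]
    (he : HasLaw e ((stdGaussian (EuclideanSpace ℝ (Fin n))).map fun x => (σ : ℝ) • x) P)
    (A : Matrix (Fin n) (Fin n) ℝ) (f : EuclideanSpace ℝ (Fin n)) :
    Integrable (fun ω => ‖f - A.toEuclideanLin (f + e ω)‖ ^ 2) P := by
  refine (integrable_norm_add_noise_sq he A (A.toEuclideanLin f - f)).congr
    (ae_of_all _ fun ω => ?_)
  simp only [map_add]
  rw [norm_sub_rev, sub_add_eq_add_sub]

theorem integral_loss
    (he : HasLaw e ((stdGaussian (EuclideanSpace ℝ (Fin n))).map fun x => (σ : ℝ) • x) P)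
    (A : Matrix (Fin n) (Fin n) ℝ) (f : EuclideanSpace ℝ (Fin n)) :
    ∫ ω, ‖f - A.toEuclideanLin (f + e ω)‖ ^ 2 ∂P =
      ‖f - A.toEuclideanLin f‖ ^ 2 + (σ : ℝ) ^ 2 * (A.transpose * A).trace := by
  rw [norm_sub_rev f, ← integral_norm_add_noise_sq he A (A.toEuclideanLin f - f)]
  refine integral_congr_ae (ae_of_all _ fun ω => ?_)
  simp only [map_add]
  rw [norm_sub_rev, sub_add_eq_add_sub]

/-- The constant in the bound on the expected criterion of a single estimator. -/
noncomputable def critConst (K α κ : ℝ) : ℝ := 16 + 2 * α + 16 * K * (penConst κ / (1 - κ))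

theorem exists_crit_bound
    (he : HasLaw e ((stdGaussian (EuclideanSpace ℝ (Fin n))).map fun x => (σ : ℝ) • x) P)
    [IsProbabilityMeasure P]
    (A : Matrix (Fin n) (Fin n) ℝ) (f : EuclideanSpace ℝ (Fin n)) {K α : ℝ}
    (hK : 1 < K) (hα : 0 < α) (hκ0 : 0 < κ) (hκ1 : κ < 1) (ha : 1 ≤ a)
    (hd : finrank ℝ (singularSpace A) + 2 ≤ n) (hw : weight a (singularSpace A) ≤ κ * n) :
    ∃ B : Ω → ℝ, Integrable B P ∧
      (∀ ω, ‖f + e ω - (singularSpace A).starProjection (A.toEuclideanLin (f + e ω))‖ ^ 2 +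
        α * ‖A.toEuclideanLin (f + e ω) -
          (singularSpace A).starProjection (A.toEuclideanLin (f + e ω))‖ ^ 2 +
        K * penDelta (weight a) (singularSpace A) * sigmaHatSq (singularSpace A) (f + e ω) -
          ‖e ω‖ ^ 2 ≤ B ω) ∧
      ∫ ω, B ω ∂P ≤ critConst K α κ * a *
        (∫ ω, ‖f - A.toEuclideanLin (f + e ω)‖ ^ 2 ∂P + (σ : ℝ) ^ 2) := by
  set S := singularSpace A with hS
  obtain ⟨W, hSW, hf, hW⟩ := S.exists_le_mem_finrank_eq_succ (by simpa using by omega) f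
  have hp := (isPenValue_penDelta_weight hκ0 hκ1 ha hd hw).1
  have hK0 : 0 < K := by linarith
  have hX := integrable_loss he A f
  have hA : Integrable (fun ω => ‖A.toEuclideanLin (e ω)‖ ^ 2) P := by
    simpa using integrable_norm_add_noise_sq he A 0
  have hAi : ∫ ω, ‖A.toEuclideanLin (e ω)‖ ^ 2 ∂P = (σ : ℝ) ^ 2 * (A.transpose * A).trace := by
    simpa using integral_norm_add_noise_sq he A 0
  have hWi := integrable_norm_starProjection_noise_sq he W
  have he2 := integrable_noise_sq he
  set b := ‖f - A.toEuclideanLin f‖ ^ 2 with hb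
  set q := K * penDelta (weight a) S / ((n : ℝ) - finrank ℝ S) with hq
  have hB1 : Integrable (fun ω => 4 * ‖f - A.toEuclideanLin (f + e ω)‖ ^ 2 +
      (8 + 2 * α) * b) P := (hX.const_mul _).add (integrable_const _)
  have hB2 : Integrable (fun ω => 4 * ‖f - A.toEuclideanLin (f + e ω)‖ ^ 2 +
      (8 + 2 * α) * b + (8 + 2 * α) * ‖A.toEuclideanLin (e ω)‖ ^ 2) P :=
    hB1.add (hA.const_mul _)
  have hB3 : Integrable (fun ω => 4 * ‖f - A.toEuclideanLin (f + e ω)‖ ^ 2 +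
      (8 + 2 * α) * b + (8 + 2 * α) * ‖A.toEuclideanLin (e ω)‖ ^ 2 +
      ‖W.starProjection (e ω)‖ ^ 2) P := hB2.add hWi
  have hB4 : Integrable (fun ω => 8 * b + 2 * ‖e ω‖ ^ 2) P :=
    (integrable_const _).add (he2.const_mul _)
  refine ⟨fun ω => 4 * ‖f - A.toEuclideanLin (f + e ω)‖ ^ 2 +
      (8 + 2 * α) * b + (8 + 2 * α) * ‖A.toEuclideanLin (e ω)‖ ^ 2 +
      ‖W.starProjection (e ω)‖ ^ 2 + q * (8 * b + 2 * ‖e ω‖ ^ 2),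
    hB3.add (hB4.const_mul _), fun ω => ?_, ?_⟩
  · exact crit_term_singularSpace_le A hSW hf (by rw [← hS]; omega) (by positivity) hα (e ω)
  · rw [integral_add hB3 (hB4.const_mul _), integral_add hB2 hWi,
      integral_add hB1 (hA.const_mul _), integral_add (hX.const_mul _) (integrable_const _),
      integral_const_mul _ (fun ω => 8 * b + 2 * ‖e ω‖ ^ 2),
      integral_add (integrable_const _) (he2.const_mul _), integral_const_mul, integral_const_mul,
      integral_const_mul, integral_const_mul 2, hAi,
      integral_norm_starProjection_noise_sq he, integral_noise_sq he, integral_loss he, hW]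
    simp only [integral_const, probReal_univ, one_smul]
    rw [← hb]
    set t := (A.transpose * A).trace
    have ht : (finrank ℝ S : ℝ) ≤ 4 * t := finrank_singularSpace_le A
    have hs : 0 ≤ (σ : ℝ) ^ 2 := sq_nonneg _
    have hb0 : 0 ≤ b := sq_nonneg _
    have ht0 : 0 ≤ t := by linarith [(Nat.cast_nonneg _ : (0 : ℝ) ≤ finrank ℝ S)]
    set c := penConst κ / (1 - κ) with hc
    have hc0 : 0 < c := div_pos (penConst_pos κ) (by linarith)
    -- Two bounds on q are needed: a constant one against the bias b, and the next one against nσ²,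
    -- where the dimension bound turns Δ into a(1 + 4t) and the factor a enters.
    have hq1 : q ≤ K * c := by
      rw [hq, mul_div_assoc]
      exact mul_le_mul_of_nonneg_left (penDelta_weight_div_le hκ0 hκ1 ha hd hw) hK0.le
    have hq2 : q * n ≤ K * c * (a * (1 + 4 * t)) := by
      have h1 := penDelta_weight_mul_div_le hκ0 hκ1 ha hd hw
      have h2 : weight a S ≤ a * (1 + 4 * t) := (weight_le ha).trans (by gcongr)
      rw [hq, mul_div_assoc, mul_assoc, mul_assoc]
      exact mul_le_mul_of_nonneg_left (h1.trans (mul_le_mul_of_nonneg_left h2 hc0.le)) hK0.le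
    have hst : 0 ≤ (σ : ℝ) ^ 2 * t := mul_nonneg hs ht0
    have hKc : 0 < K * c := mul_pos hK0 hc0
    have hM0 : 0 ≤ b + (σ : ℝ) ^ 2 * t + (σ : ℝ) ^ 2 := by positivity
    have e1 : q * (8 * b) ≤ K * c * (8 * b) := mul_le_mul_of_nonneg_right hq1 (by positivity)
    have e2 : q * (2 * ((σ : ℝ) ^ 2 * n)) ≤
        8 * (K * c) * a * ((σ : ℝ) ^ 2 * t + (σ : ℝ) ^ 2) := by
      have := mul_le_mul_of_nonneg_left hq2 (mul_nonneg zero_le_two hs)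
      have h3 : 0 ≤ K * c * a * (σ : ℝ) ^ 2 := by positivity
      linarith
    have e3 : (σ : ℝ) ^ 2 * ((finrank ℝ S + 1 : ℕ) : ℝ) ≤ 4 * ((σ : ℝ) ^ 2 * t) + (σ : ℝ) ^ 2 := by
      push_cast
      linarith [mul_le_mul_of_nonneg_left ht hs]
    have e4 : (16 + 2 * α + 8 * (K * c)) * (b + (σ : ℝ) ^ 2 * t + (σ : ℝ) ^ 2) ≤
        (16 + 2 * α + 8 * (K * c)) * a * (b + (σ : ℝ) ^ 2 * t + (σ : ℝ) ^ 2) := by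
      refine mul_le_mul_of_nonneg_right (le_mul_of_one_le_right (by positivity) ha) hM0
    have e5 : 8 * (K * c) * a * ((σ : ℝ) ^ 2 * t + (σ : ℝ) ^ 2) ≤
        8 * (K * c) * a * (b + (σ : ℝ) ^ 2 * t + (σ : ℝ) ^ 2) :=
      mul_le_mul_of_nonneg_left (by linarith) (by positivity)
    have e6 : 4 * (b + (σ : ℝ) ^ 2 * t) + (8 + 2 * α) * b + (8 + 2 * α) * ((σ : ℝ) ^ 2 * t) +
        (4 * ((σ : ℝ) ^ 2 * t) + (σ : ℝ) ^ 2) + K * c * (8 * b) ≤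
        (16 + 2 * α + 8 * (K * c)) * (b + (σ : ℝ) ^ 2 * t + (σ : ℝ) ^ 2) := by
      have h1 := mul_nonneg hα.le hs
      have h3 := mul_nonneg hKc.le hs
      have h4 := mul_nonneg hKc.le hst
      linarith
    have e7 : critConst K α κ * a * (b + (σ : ℝ) ^ 2 * t + (σ : ℝ) ^ 2) =
        (16 + 2 * α + 8 * (K * c)) * a * (b + (σ : ℝ) ^ 2 * t + (σ : ℝ) ^ 2) +
        8 * (K * c) * a * (b + (σ : ℝ) ^ 2 * t + (σ : ℝ) ^ 2) := by
      rw [critConst, ← hc]; ring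
    rw [e7, mul_add]
    linarith

/-- The exceptional null set does not depend on 𝕋 or g, so the bound may be applied to the random
collection and estimator selected by λ̂. -/
theorem exists_deviation_bound
    (he : HasLaw e ((stdGaussian (EuclideanSpace ℝ (Fin n))).map fun x => (σ : ℝ) • x) P)
    (f : EuclideanSpace ℝ (Fin n)) {𝕊 : Set (Submodule ℝ (EuclideanSpace ℝ (Fin n)))}
    (hκ0 : 0 < κ) (hκ1 : κ < 1) (ha : 1 ≤ a) (hc : 𝕊.Countable)
    (hd : ∀ S ∈ 𝕊, finrank ℝ S + 2 ≤ n) (hw : ∀ S ∈ 𝕊, weight a S ≤ κ * n)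
    (hs : Summable fun S : 𝕊 => Real.exp (-weight a S.1))
    (hs1 : ∑' S : 𝕊, Real.exp (-weight a S.1) ≤ 1) {K α : ℝ} (hK : 1 < K) (hα : 0 < α) :
    ∃ Z : Ω → ℝ, Integrable Z P ∧ ∫ ω, Z ω ∂P ≤ (σ : ℝ) ^ 2 ∧
      ∀ᵐ ω ∂P, ∀ 𝕋 ⊆ 𝕊, 𝕋.Nonempty → ∀ g,
        min (1 - K⁻¹) α / 2 * ‖f - g‖ ^ 2 + ‖e ω‖ ^ 2 - K * Z ω ≤
          crit α (fun S => K * penDelta (weight a) S) 𝕋 (f + e ω) g := by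
  have hW : ∀ S : 𝕊, ∃ W : Submodule ℝ (EuclideanSpace ℝ (Fin n)), S.1 ≤ W ∧ f ∈ W ∧
      finrank ℝ W = finrank ℝ S.1 + 1 := fun S =>
    S.1.exists_le_mem_finrank_eq_succ (by have := hd S S.2; simpa using by omega) f
  choose W hSW hf hW using hW
  have hcount : Countable 𝕊 := hc.to_subtype
  have hint : ∀ S : 𝕊, ∫ ω, max (‖(W S).starProjection (e ω)‖ ^ 2 -
      penDelta (weight a) S.1 / ((n : ℝ) - finrank ℝ S.1) *
        ‖e ω - (W S).starProjection (e ω)‖ ^ 2) 0 ∂P =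
      (σ : ℝ) ^ 2 * Real.exp (-weight a S.1) := by
    intro S
    have hl : finrank ℝ (W S)ᗮ = n - finrank ℝ S.1 - 1 := by
      have h1 := (W S).finrank_add_finrank_orthogonal
      rw [finrank_euclideanSpace_fin, hW S] at h1
      omega
    rw [integral_posPart_noise he (W S) (hW S) hl,
      (isPenValue_penDelta_weight hκ0 hκ1 ha (hd S S.2) (hw S S.2)).2]
  obtain ⟨Z, hZ, hZle, hZi⟩ := exists_integrable_forall_le
    (fun S : 𝕊 => integrable_posPart_noise he (W S)
      (penDelta (weight a) S.1 / ((n : ℝ) - finrank ℝ S.1)))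
    (fun S ω => le_max_right _ _) (by simpa only [hint] using hs.mul_left _)
  refine ⟨Z, hZ, ?_, ?_⟩
  · rw [hZi]
    simp only [hint]
    rw [tsum_mul_left]
    exact mul_le_of_le_one_right (sq_nonneg _) hs1
  · filter_upwards [hZle] with ω hω 𝕋 h𝕋 hne g
    have : Nonempty 𝕋 := hne.to_subtype
    refine le_ciInf fun S => ?_
    have hS := h𝕋 S.2
    have hp := (isPenValue_penDelta_weight hκ0 hκ1 ha (hd _ hS) (hw _ hS)).1
    have hSn : finrank ℝ S.1 < n := by
      have := hd _ hS
      omega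
    refine le_trans ?_ (loss_le_crit_term (hSW ⟨S, hS⟩) (hf ⟨S, hS⟩) hSn hp hK hα (e ω) g)
    exact sub_le_sub_left (mul_le_mul_of_nonneg_left (hω ⟨S, hS⟩) (by linarith)) _

/-- The loss is a finite sum of integrable losses cut off to the events {λ̂ = l}. -/
theorem integrable_selected_loss [IsFiniteMeasure P]
    (he : HasLaw e ((stdGaussian (EuclideanSpace ℝ (Fin n))).map fun x => (σ : ℝ) • x) P)
    {Λ : Type*} [Finite Λ] (A : Λ → Matrix (Fin n) (Fin n) ℝ) (f : EuclideanSpace ℝ (Fin n))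
    {lhat : Ω → Λ} (hl : ∀ l, MeasurableSet (lhat ⁻¹' {l})) :
    Integrable (fun ω => ‖f - (A (lhat ω)).toEuclideanLin (f + e ω)‖ ^ 2) P := by
  classical
  have := Fintype.ofFinite Λ
  have h : Integrable (fun ω => ∑ l, (lhat ⁻¹' {l}).indicator
      (fun ω => ‖f - (A l).toEuclideanLin (f + e ω)‖ ^ 2) ω) P :=
    integrable_finsetSum _ fun l _ => (integrable_loss he (A l) f).indicator (hl l)
  refine h.congr (ae_of_all _ fun ω => ?_)
  simp [Set.indicator_apply]

theorem oracle_inequality [IsProbabilityMeasure P]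
    (he : HasLaw e ((stdGaussian (EuclideanSpace ℝ (Fin n))).map fun x => (σ : ℝ) • x) P)
    (f : EuclideanSpace ℝ (Fin n)) {Λ : Type*} [Finite Λ]
    (A : Λ → Matrix (Fin n) (Fin n) ℝ)
    (𝕊 : Λ → Set (Submodule ℝ (EuclideanSpace ℝ (Fin n)))) {K α : ℝ} (hK : 1 < K) (hα : 0 < α)
    (hκ0 : 0 < κ) (hκ1 : κ < 1) (ha : 1 ≤ a)
    (hA : ∀ l, singularSpace (A l) ∈ 𝕊 l) (hc : (⋃ l, 𝕊 l).Countable)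
    (hd : ∀ S ∈ ⋃ l, 𝕊 l, finrank ℝ S + 2 ≤ n)
    (hs : Summable fun S : ↥(⋃ l, 𝕊 l) => Real.exp (-weight a S.1))
    (hs1 : ∑' S : ↥(⋃ l, 𝕊 l), Real.exp (-weight a S.1) ≤ 1)
    (hw : ∀ S ∈ ⋃ l, 𝕊 l, weight a S ≤ κ * n) {lhat : Ω → Λ}
    (hl : ∀ l, MeasurableSet (lhat ⁻¹' {l}))
    (hmin : ∀ᵐ ω ∂P, ∀ l,
      crit α (fun S => K * penDelta (weight a) S) (𝕊 (lhat ω)) (f + e ω)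
          ((A (lhat ω)).toEuclideanLin (f + e ω)) ≤
        crit α (fun S => K * penDelta (weight a) S) (𝕊 l) (f + e ω)
          ((A l).toEuclideanLin (f + e ω))) (l : Λ) :
    min (1 - K⁻¹) α / 2 * ∫ ω, ‖f - (A (lhat ω)).toEuclideanLin (f + e ω)‖ ^ 2 ∂P ≤
      (critConst K α κ + K) * a *
        (∫ ω, ‖f - (A l).toEuclideanLin (f + e ω)‖ ^ 2 ∂P + (σ : ℝ) ^ 2) := by
  have hmem : ∀ l, ∀ S ∈ 𝕊 l, S ∈ ⋃ l, 𝕊 l := fun l S hS => Set.mem_iUnion_of_mem l hS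
  obtain ⟨Z, hZ, hZi, hZle⟩ := exists_deviation_bound he f hκ0 hκ1 ha hc hd hw hs hs1 hK hα
  obtain ⟨B, hB, hBle, hBi⟩ := exists_crit_bound he (A l) f hK hα hκ0 hκ1 ha
    (hd _ (hmem l _ (hA l))) (hw _ (hmem l _ (hA l)))
  have hL := integrable_selected_loss he A f hl
  have hK0 : 0 < K := by linarith
  have hpen : ∀ S ∈ 𝕊 l, 0 ≤ K * penDelta (weight a) S := fun S hS =>
    mul_nonneg hK0.le
      (isPenValue_penDelta_weight hκ0 hκ1 ha (hd _ (hmem l _ hS)) (hw _ (hmem l _ hS))).1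
  have hle : ∀ᵐ ω ∂P, min (1 - K⁻¹) α / 2 *
      ‖f - (A (lhat ω)).toEuclideanLin (f + e ω)‖ ^ 2 ≤ B ω + K * Z ω := by
    filter_upwards [hZle, hmin] with ω h1 h2
    -- Lower bound at λ̂, minimality, then upper bound at l through S_l; ‖e ω‖² occurs on both sides
    -- and cancels.
    have h3 := h1 (𝕊 (lhat ω)) (hmem _) ⟨_, hA _⟩ ((A (lhat ω)).toEuclideanLin (f + e ω))
    have h4 := crit_le_of_mem (pen := fun S => K * penDelta (weight a) S) hα.le hpen
      (fun S hS => by have := hd _ (hmem l _ hS); omega) (hA l) (f + e ω)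
      ((A l).toEuclideanLin (f + e ω))
    linarith [h2 l, hBle ω]
  have hint := integral_mono_ae (hL.const_mul _) (hB.add (hZ.const_mul K)) hle
  rw [integral_const_mul, integral_add' hB (hZ.const_mul K), integral_const_mul] at hint
  have hR : 0 ≤ ∫ ω, ‖f - (A l).toEuclideanLin (f + e ω)‖ ^ 2 ∂P :=
    integral_nonneg fun ω => sq_nonneg _
  have h5 := mul_le_mul_of_nonneg_left hZi hK0.le
  have h6 : K * (σ : ℝ) ^ 2 ≤
      K * a * (∫ ω, ‖f - (A l).toEuclideanLin (f + e ω)‖ ^ 2 ∂P + (σ : ℝ) ^ 2) := by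
    rw [mul_assoc]
    refine mul_le_mul_of_nonneg_left ?_ hK0.le
    nlinarith [sq_nonneg (σ : ℝ)]
  linarith

end Risk

theorem corollary2 (K κ α : ℝ) (hK : 1 < K) (hκ0 : 0 < κ) (hκ1 : κ < 1) (hα : 0 < α) :
    (∃ C : ℝ, 0 < C ∧
      ∀ (n : ℕ) (Λ : Type*) [Finite Λ] (A : Λ → Matrix (Fin n) (Fin n) ℝ)
        (𝕊 : Λ → Set (Submodule ℝ (EuclideanSpace ℝ (Fin n)))) (a : ℝ),
        (∀ l, singularSpace (A l) ∈ 𝕊 l) →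
        (⋃ l, 𝕊 l).Countable →
        (∀ S ∈ ⋃ l, 𝕊 l, finrank ℝ S + 2 ≤ n) →
        1 ≤ a →
        Summable (fun S : ↥(⋃ l, 𝕊 l) => Real.exp (-weight a S.1)) →
        ∑' S : ↥(⋃ l, 𝕊 l), Real.exp (-weight a S.1) ≤ 1 →
        (∀ S ∈ ⋃ l, 𝕊 l, weight a S ≤ κ * n) →
        ∀ (Ω : Type*) [MeasurableSpace Ω] (P : Measure Ω) [IsProbabilityMeasure P]
          (f : EuclideanSpace ℝ (Fin n)) (σ : NNReal) (ε : Fin n → Ω → ℝ),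
          iIndepFun ε P →
          (∀ i, HasLaw (ε i) (gaussianReal 0 (σ ^ 2)) P) →
          ∀ lhat : Ω → Λ,
            (∀ l, MeasurableSet (lhat ⁻¹' {l})) →
            (∀ᵐ ω ∂P, ∀ l,
              crit α (fun S => K * penDelta (weight a) S) (𝕊 (lhat ω)) (observation f ε ω)
                  ((A (lhat ω)).toEuclideanLin (observation f ε ω)) ≤
                crit α (fun S => K * penDelta (weight a) S) (𝕊 l) (observation f ε ω)
                  ((A l).toEuclideanLin (observation f ε ω))) →
            Integrable
                (fun ω => ‖f - (A (lhat ω)).toEuclideanLin (observation f ε ω)‖ ^ 2) P ∧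
              C * a⁻¹ * ∫ ω, ‖f - (A (lhat ω)).toEuclideanLin (observation f ε ω)‖ ^ 2 ∂P ≤
                (⨅ l, ∫ ω, ‖f - (A l).toEuclideanLin (observation f ε ω)‖ ^ 2 ∂P) +
                  (σ : ℝ) ^ 2) ∧
    (∀ (n : ℕ) (A : Matrix (Fin n) (Fin n) ℝ) (f : EuclideanSpace ℝ (Fin n)),
      ‖A.toEuclideanLin f - (singularSpace A).starProjection (A.toEuclideanLin f)‖ ≤
          ‖f - A.toEuclideanLin f‖ ∧
        (finrank ℝ (singularSpace A) : ℝ) ≤ 4 * (A.transpose * A).trace) := by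
  have hm : 0 < min (1 - K⁻¹) α / 2 :=
    half_pos (lt_min (sub_pos.2 (inv_lt_one_of_one_lt₀ hK)) hα)
  have hc : 0 < critConst K α κ := by
    have := div_pos (penConst_pos κ) (sub_pos.2 hκ1)
    unfold critConst
    positivity
  have hD : 0 < critConst K α κ + K := by linarith
  refine ⟨⟨min (1 - K⁻¹) α / 2 / (critConst K α κ + K), div_pos hm hD, ?_⟩, fun n A f =>
    ⟨norm_toEuclideanLin_sub_singularSpace_le A f, finrank_singularSpace_le A⟩⟩
  intro n Λ _ A 𝕊 a hA hcount hd ha hs hs1 hw Ω _ P _ f σ ε hε hlaw lhat hl hmin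
  have he := hasLaw_toLp_gaussian hε hlaw
  refine ⟨integrable_selected_loss he A f hl, ?_⟩
  obtain ⟨ω₀⟩ : Nonempty Ω := nonempty_of_isProbabilityMeasure P
  -- Nonemptiness of Λ makes the infimum over Λ genuine, so that it suffices to bound each l.
  have : Nonempty Λ := ⟨lhat ω₀⟩
  rw [ciInf_add (Set.finite_range _).bddBelow]
  refine le_ciInf fun l => ?_
  have h := oracle_inequality he f A 𝕊 hK hα hκ0 hκ1 ha hA hcount hd hs hs1 hw hl hmin l
  have ha0 : 0 < a := by linarith
  rw [← div_eq_mul_inv, div_div, div_mul_eq_mul_div, div_le_iff₀ (mul_pos hD ha0),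
    mul_comm _ (_ * a)]
  exact h
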